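/- **Setting.** For every point $x$ of a set $X$ let $\mathcal B_x$ be a Boolean $\sigma$-semiring of subsets of a set $\mathrm E_x$: $\mathcal B_x$ contains $\mathrm E_x$ and $\emptyset$, is closed under intersections $BB'=B\cap B'$, and every $B\in\mathcal B_x$ is a member of some countable partition $\mathrm E_x=\sum_{m=1}^\infty B^m$ with $B^m\in\mathcal B_x$ (a sum of sets denotes a union of pairwise disjoint sets). Let $X$ be partially ordered (for instance linearly ordered, or with the trivial order in which distinct points are incomparable), let $\mathrm T=\mathbb Z\times X$ with the lexicographic order, $(l,x)<(l',x')$ iff $l<l'$, or $l=l'$ and $x<x'$, and let $S=\mathbb Z$ act on $\mathrm T$ by $s(l,x)=(l+s,x)$. Put $\mathcal B_{\mathrm t}=\mathcal B_x$, $\mathrm E_{\mathrm t}=\mathrm E_x$ for $\mathrm t=(l,x)$, and $\mathcal B^\Lambda=\prod_{\mathrm t\in\Lambda}\mathcal B_{\mathrm t}$ for a finite chain $\Lambda\subset\mathrm T$; $\mathbf e=(\mathrm E_{\mathrm t})_{\mathrm t\in\Lambda}$. A *quantum stochastic process (QSP) in the narrow sense* over a family $(\mathcal B_t)$ on a complex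 Hilbert space $\mathcal H$ consists of a unit vector $\xi\in\mathcal H$ and of maps $\pi_t$ from $\mathcal B_t$ to the orthogonal projections of $\mathcal H$ with $\pi_t(\mathrm E_t)=\mathrm I$ which are $\sigma$-homomorphisms: if $\mathrm E_t=\sum_{m=1}^\infty B^m$ with $B^m\in\mathcal B_t$, then the projections $\pi_t(B^m)$ are mutually orthogonal and $\sum_{m=1}^\infty\pi_t(B^m)=\mathrm I$ strongly. A QSP over $(\mathcal B_{\mathrm t})_{\mathrm t\in\mathrm T}$ is *$S$-quasiconstant* if $\pi_{\mathrm t}(B)=\pi_{s\mathrm t}(B)$ for all $s\in\mathbb Z$, $\mathrm t\in\mathrm T$, $B\in\mathcal B_{\mathrm t}$. It *induces* the kernels $$\kappa^\Lambda(\mathbf b,\mathbf b')=(\xi^\Lambda(\mathbf b)\mid\xi^\Lambda(\mathbf b')),\qquad \xi^\Lambda(\mathbf b)=\pi_{\mathrm t_n}(\mathbf b(\mathrm t_n))\cdots\pi_{\mathrm t_1}(\mathbf b(\mathrm t_1))\xi,\qquad \Lambda=\{\mathrm t_1<\dots<\mathrm t_n\}.$$ **Hypotheses.** Let $\kappa^\Lambda:\mathcal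 B^\Lambda\times\mathcal B^\Lambda\to\mathbb C$ be given for every finite chain $\Lambda\subset\mathrm T$. Suppose that the system is projective: $\kappa^\Lambda(\mathbf b,\mathbf b')=\kappa^{\mathrm M}(\hat{\mathbf b},\hat{\mathbf b}')$ for chains $\Lambda\subseteq\mathrm M$, where $\hat{\mathbf b}$ extends $\mathbf b$ by $\hat{\mathbf b}(\mathrm t)=\mathrm E_{\mathrm t}$, $\mathrm t\in\mathrm M\setminus\Lambda$; and that for every $\Lambda$ (in 3 and 4, $\Lambda\ne\emptyset$ and $\mathrm t_n=\max\Lambda$): 1. $\sum_{i,j=1}^m\kappa^\Lambda(\mathbf b^i,\mathbf b^j)\bar c_ic_j\ge0$ for all $m$, $\mathbf b^i\in\mathcal B^\Lambda$, $c_i\in\mathbb C$; 2. $\kappa^\Lambda(\mathbf e,\mathbf e)=1$; 3. $\kappa^\Lambda(\mathbf b,\mathbf b)=\sum_{m=1}^\infty\kappa^\Lambda(\mathbf b^m,\mathbf b^m)$ whenever $\mathbf b^m(\mathrm t)=\mathbf b(\mathrm t)$ for $\mathrm t\neq\mathrm t_n$ and $\mathbf b(\mathrm t_n)=\sum_{m=1}^\infty\mathbf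 b^m(\mathrm t_n)$; 4. $\kappa^\Lambda(\mathbf bB,\mathbf b')=\kappa^\Lambda(\mathbf b,\mathbf b'B)$ for $B\in\mathcal B_{\mathrm t_n}$, where $\mathbf bB$ arises from $\mathbf b$ by replacing $\mathbf b(\mathrm t_n)$ with $\mathbf b(\mathrm t_n)\cap B$; and that the system is ultrastationary: 5'. For $\boldsymbol x\in X^n$ and $\boldsymbol s\in\mathbb Z^n$ such that the points $\mathrm t_i=(s_i,x_i)$ satisfy $\mathrm t_1\le\dots\le\mathrm t_n$ (repetitions allowed), and for sequences of events $B_i,B_i'\in\mathcal B_{x_i}$, let $\kappa^{\boldsymbol s}_{\boldsymbol x}((B_i),(B_i'))=\kappa^\Lambda(\mathbf b,\mathbf b')$, where $\Lambda=\{\mathrm t_1,\dots,\mathrm t_n\}$, $\mathbf b(\mathrm t)=\bigcap_{i:\,\mathrm t_i=\mathrm t}B_i$ and $\mathbf b'(\mathrm t)=\bigcap_{i:\,\mathrm t_i=\mathrm t}B'_i$. Then $\kappa^{\boldsymbol s}_{\boldsymbol x}=\kappa_{\boldsymbol x}$ does not depend on $\boldsymbol s$. **Theorem 1.** There exist a Hilbert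 space $\mathcal H$, a family of $\sigma$-homomorphisms $\pi_{\mathrm t}$ from $\mathcal B_{\mathrm t}$ to the projections of $\mathcal H$ with $\pi_{\mathrm t}(\mathrm E_{\mathrm t})=\mathrm I$, $\mathrm t\in\mathrm T$, and a state vector $\xi\in\mathcal H$ that form an $S$-quasiconstant QSP in the narrow sense which induces $\{\kappa^\Lambda\}$. They can be chosen minimal, i.e. such that $\xi$ is separating for the commutant $\mathcal A=\bigcap_{\mathrm t}\pi_{\mathrm t}(\mathcal B_{\mathrm t})'$ ($A\in\mathcal A$, $A\xi=0$ imply $A=0$), and then $\pi_x=\pi_{(l,x)}$, $x\in X$, with $\xi$, is a QSP in the narrow sense over $(\mathcal B_x)_{x\in X}$ such that for all sequences $\boldsymbol x\in X^n$ $$\kappa_{\boldsymbol x}((B_i),(B'_i))=\bigl(\pi_{x_n}(B_n)\cdots\pi_{x_1}(B_1)\xi\mid\pi_{x_n}(B'_n)\cdots\pi_{x_1}(B'_1)\xi\bigr).$$ The minimal process is unique up to unitary equivalence: for any two minimal $S$-quasiconstant narrow-sense QSPs $(\mathcal H_1,\pi^1,\xi_1)$ and $(\mathcal H_2,\pi^2,\xi_2)$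 that induce $\{\kappa^\Lambda\}$ there is a unitary $U:\mathcal H_1\to\mathcal H_2$ with $U\xi_1=\xi_2$ and $U\pi^1_{\mathrm t}(B)=\pi^2_{\mathrm t}(B)U$ for all $\mathrm t\in\mathrm T$, $B\in\mathcal B_{\mathrm t}$. -/

import Mathlib

open scoped ComplexOrder ComplexConjugate InnerProductSpace

universe u v w w'

/-! ### Boolean σ-semirings of events -/

/-- A Boolean `σ`-semiring of subsets of `E`: it contains `E` and `∅`, is closed under
intersections, and each of its members belongs to a countable partition of `E` into members. -/
structure SigmaSemiring (E : Type v) where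
  sets : Set (Set E)
  univ_mem : Set.univ ∈ sets
  empty_mem : ∅ ∈ sets
  inter_mem : ∀ A ∈ sets, ∀ B ∈ sets, A ∩ B ∈ sets
  exists_partition : ∀ B ∈ sets, ∃ f : ℕ → Set E, (∀ m, f m ∈ sets) ∧
    Pairwise (fun m m' => f m ∩ f m' = ∅) ∧ (⋃ m, f m) = Set.univ ∧ ∃ m, f m = B

namespace SigmaSemiring

variable {E : Type v}

/-- The events, i.e. the members of the semiring. -/
def Event (𝓑 : SigmaSemiring E) : Type v := {B : Set E // B ∈ 𝓑.sets}

/-- The sure event `E`. -/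
def sure (𝓑 : SigmaSemiring E) : 𝓑.Event := ⟨Set.univ, 𝓑.univ_mem⟩

/-- The product `B B' = B ∩ B'` of events. -/
def mul (𝓑 : SigmaSemiring E) (B B' : 𝓑.Event) : 𝓑.Event :=
  ⟨B.1 ∩ B'.1, 𝓑.inter_mem _ B.2 _ B'.2⟩

/-- `B = ∑ₘ Bᵐ`: the event `B` is the union of the pairwise disjoint events `Bᵐ`. -/
def IsDisjointSum (𝓑 : SigmaSemiring E) (B : 𝓑.Event) (f : ℕ → 𝓑.Event) : Prop :=
  Pairwise (fun m m' => (f m).1 ∩ (f m').1 = ∅) ∧ (⋃ m, (f m).1) = B.1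

theorem iInter_mem (𝓑 : SigmaSemiring E) :
    ∀ (n : ℕ) (A : Fin n → Set E), (∀ i, A i ∈ 𝓑.sets) → (⋂ i, A i) ∈ 𝓑.sets := by
  intro n
  induction n with
  | zero =>
    intro A _
    rw [Set.iInter_of_empty]
    exact 𝓑.univ_mem
  | succ n ih =>
    intro A hA
    have h : (⋂ i, A i) = A 0 ∩ ⋂ i : Fin n, A i.succ := by
      ext p
      simp [Fin.forall_fin_succ]
    rw [h]
    exact 𝓑.inter_mem _ (hA 0) _ (ih _ fun i => hA i.succ)

end SigmaSemiring

/-! ### Chains and multikernels -/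

section Kernels

variable {T : Type u} [PartialOrder T] {E : T → Type v}

/-- Finite chains `Λ ⊂ T`. -/
def FinChain (T : Type u) [PartialOrder T] : Type u :=
  {Λ : Finset T // IsChain (· ≤ ·) (Λ : Set T)}

/-- `𝓑^Λ`, the product of the `𝓑_t` over `t ∈ Λ`. -/
def EventSeq (𝓑 : ∀ t, SigmaSemiring (E t)) (Λ : FinChain T) : Type (max u v) :=
  ∀ t : Λ.1, (𝓑 t).Event

/-- The element `e = (E_t)` of `𝓑^Λ`. -/
def sureSeq (𝓑 : ∀ t, SigmaSemiring (E t)) (Λ : FinChain T) : EventSeq 𝓑 Λ :=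
  fun t => (𝓑 t).sure

open Classical in
/-- The extension of `b ∈ 𝓑^Λ` to `𝓑^M` by the sure events `E_t` at `t ∈ M \ Λ`. -/
noncomputable def extendSeq {𝓑 : ∀ t, SigmaSemiring (E t)} {Λ : FinChain T} (M : FinChain T)
    (b : EventSeq 𝓑 Λ) : EventSeq 𝓑 M :=
  fun t => if h : t.1 ∈ Λ.1 then b ⟨t.1, h⟩ else (𝓑 t).sure

open Classical in
/-- `b B`: the component of `b` at `t` is multiplied by `B`, the others are kept. -/
noncomputable def mulAt {𝓑 : ∀ t, SigmaSemiring (E t)} {Λ : FinChain T} (b : EventSeq 𝓑 Λ)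
    (t : Λ.1) (B : (𝓑 t).Event) : EventSeq 𝓑 Λ :=
  Function.update b t ((𝓑 t).mul (b t) B)

/-- A system of scalar multikernels `κ^Λ : 𝓑^Λ × 𝓑^Λ → ℂ`, one for every finite chain. -/
def Multikernels (𝓑 : ∀ t, SigmaSemiring (E t)) : Type (max u v) :=
  ∀ Λ : FinChain T, EventSeq 𝓑 Λ → EventSeq 𝓑 Λ → ℂ

namespace Multikernels

variable {𝓑 : ∀ t, SigmaSemiring (E t)}

/-- Projectivity. -/
def IsProjective (κ : Multikernels 𝓑) : Prop :=
  ∀ Λ M : FinChain T, Λ.1 ⊆ M.1 → ∀ b b' : EventSeq 𝓑 Λ,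
    κ Λ b b' = κ M (extendSeq M b) (extendSeq M b')

/-- Positivity (the order on `ℂ` is `z ≤ w ↔ re z ≤ re w ∧ im z = im w`). -/
def IsPositive (κ : Multikernels 𝓑) : Prop :=
  ∀ (Λ : FinChain T) (m : ℕ) (b : Fin m → EventSeq 𝓑 Λ) (c : Fin m → ℂ),
    0 ≤ ∑ i, ∑ j, κ Λ (b i) (b j) * conj (c i) * c j

/-- Normalization. -/
def IsNormalized (κ : Multikernels 𝓑) : Prop :=
  ∀ Λ : FinChain T, κ Λ (sureSeq 𝓑 Λ) (sureSeq 𝓑 Λ) = 1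

/-- `σ`-additivity of the diagonal in the last argument, `t = max Λ`. -/
def IsSigmaAdditive (κ : Multikernels 𝓑) : Prop :=
  ∀ (Λ : FinChain T) (t : Λ.1), (∀ r : Λ.1, r ≤ t) →
    ∀ (b : EventSeq 𝓑 Λ) (f : ℕ → EventSeq 𝓑 Λ), (∀ m r, r ≠ t → f m r = b r) →
      (𝓑 t).IsDisjointSum (b t) (fun m => f m t) →
        HasSum (fun m => κ Λ (f m) (f m)) (κ Λ b b)

/-- Factorizability in the last argument, `t = max Λ`. -/
def IsFactorizable (κ : Multikernels 𝓑) : Prop :=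
  ∀ (Λ : FinChain T) (t : Λ.1), (∀ r : Λ.1, r ≤ t) →
    ∀ (b b' : EventSeq 𝓑 Λ) (B : (𝓑 t).Event), κ Λ (mulAt b t B) b' = κ Λ b (mulAt b' t B)

end Multikernels

open Classical in
/-- The chain `{t₁, …, tₙ}` underlying a sequence `t₁ ≤ ⋯ ≤ tₙ`, which may have repetitions. -/
noncomputable def chainOf {n : ℕ} (t : Fin n → T) (ht : Monotone t) : FinChain T :=
  ⟨Finset.univ.image t, by
    intro x hx y hy _
    simp only [Finset.coe_image, Finset.coe_univ, Set.image_univ, Set.mem_range] at hx hy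
    obtain ⟨i, rfl⟩ := hx
    obtain ⟨j, rfl⟩ := hy
    exact (le_total i j).imp (fun h => ht h) (fun h => ht h)⟩

/-- The element of `𝓑^{t₁, …, tₙ}` given by a sequence of events `B_i` at the points
`t₁ ≤ ⋯ ≤ tₙ`: its component at `r` is the product (intersection) of the `B_i` with `t_i = r`.
For `t₁ < ⋯ < tₙ` the component at `t_i` is just `B_i`. -/
noncomputable def seqOf {𝓑 : ∀ t, SigmaSemiring (E t)} {n : ℕ} (t : Fin n → T) (ht : Monotone t)
    (B : ∀ i, (𝓑 (t i)).Event) : EventSeq 𝓑 (chainOf t ht) :=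
  fun r => ⟨⋂ i, {p : E r | ∀ h : r.1 = t i, h ▸ p ∈ (B i).1}, by
    obtain ⟨r, hr⟩ := r
    apply SigmaSemiring.iInter_mem
    intro i
    by_cases h : r = t i
    · subst h
      simpa using (B i).2
    · simpa [h] using (𝓑 r).univ_mem⟩

/-- The value of the multikernel on sequences of events at points `t₁ ≤ ⋯ ≤ tₙ`. -/
noncomputable def Multikernels.onSeq {𝓑 : ∀ t, SigmaSemiring (E t)} (κ : Multikernels 𝓑) {n : ℕ}
    (t : Fin n → T) (ht : Monotone t) (B B' : ∀ i, (𝓑 (t i)).Event) : ℂ :=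
  κ (chainOf t ht) (seqOf t ht B) (seqOf t ht B')

end Kernels

/-! ### Quantum stochastic processes in the narrow sense -/

/-- A quantum stochastic process in the narrow sense over `(𝓑_t)` on the Hilbert space `H`:
`σ`-homomorphisms `π_t` from `𝓑_t` to the orthogonal projections of `H`, with `π_t(E_t) = I`,
and a unit vector `ξ`. (Multiplicativity `π_t(BB') = π_t(B)π_t(B')` follows from these axioms.) -/
structure NarrowQSP {T : Type u} {E : T → Type v} (𝓑 : ∀ t, SigmaSemiring (E t))
    (H : Type w) [NormedAddCommGroup H] [InnerProductSpace ℂ H] [CompleteSpace H] where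
  π : ∀ t, (𝓑 t).Event → (H →L[ℂ] H)
  ξ : H
  isStarProjection : ∀ t B, IsStarProjection (π t B)
  map_sure : ∀ t, π t (𝓑 t).sure = ContinuousLinearMap.id ℂ H
  orthogonal : ∀ t (f : ℕ → (𝓑 t).Event), (𝓑 t).IsDisjointSum (𝓑 t).sure f →
    Pairwise fun m m' => π t (f m) ∘L π t (f m') = 0
  hasSum : ∀ t (f : ℕ → (𝓑 t).Event), (𝓑 t).IsDisjointSum (𝓑 t).sure f →
    ∀ x : H, HasSum (fun m => π t (f m) x) x
  norm_ξ : ‖ξ‖ = 1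

namespace NarrowQSP

variable {T : Type u} {E : T → Type v} {𝓑 : ∀ t, SigmaSemiring (E t)}
  {H : Type w} [NormedAddCommGroup H] [InnerProductSpace ℂ H] [CompleteSpace H]

/-- The vector `π_{tₙ}(Bₙ) ⋯ π_{t₁}(B₁) ξ`, for an arbitrary finite sequence `t₁, …, tₙ`. -/
def vec (P : NarrowQSP 𝓑 H) {n : ℕ} (t : Fin n → T) (B : ∀ i, (𝓑 (t i)).Event) : H :=
  (List.finRange n).foldl (fun v i => P.π (t i) (B i) v) P.ξ

/-- The process induces the multikernels `κ`: for every finite chain `Λ = {t₁ < ⋯ < tₙ}`,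
`κ^Λ(b, b') = (ξ^Λ(b) | ξ^Λ(b'))` with `ξ^Λ(b) = π_{tₙ}(b(tₙ)) ⋯ π_{t₁}(b(t₁)) ξ`. The order
isomorphism `t` is the (unique) increasing enumeration of `Λ`. -/
def Induces [PartialOrder T] (P : NarrowQSP 𝓑 H) (κ : Multikernels 𝓑) : Prop :=
  ∀ (Λ : FinChain T) (n : ℕ) (t : Fin n ≃o Λ.1) (b b' : EventSeq 𝓑 Λ),
    κ Λ b b' = ⟪P.vec (fun i => (t i).1) (fun i => b (t i)),
      P.vec (fun i => (t i).1) (fun i => b' (t i))⟫_ℂ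

/-- Minimality: `ξ` is separating for the commutant `⋂_t π_t(𝓑_t)'`. -/
def IsMinimal (P : NarrowQSP 𝓑 H) : Prop :=
  ∀ A : H →L[ℂ] H, (∀ t B, A ∘L P.π t B = P.π t B ∘L A) → A P.ξ = 0 → A = 0

/-- Unitary equivalence of processes. -/
def UnitarilyEquivalent {H' : Type w'} [NormedAddCommGroup H'] [InnerProductSpace ℂ H']
    [CompleteSpace H'] (P : NarrowQSP 𝓑 H) (P' : NarrowQSP 𝓑 H') : Prop :=
  ∃ U : H ≃ₗᵢ[ℂ] H', U P.ξ = P'.ξ ∧ ∀ t B x, U (P.π t B x) = P'.π t B (U x)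

end NarrowQSP

/-! ### The index set `ℤ × X`

`ℤ × X` carries the lexicographic order: `(l, x) < (l', x')` iff `l < l'`, or `l = l'` and `x < x'`.
The order of `X` is arbitrary. If `X` is linearly ordered, so is `ℤ × X`; for the discrete order
on `X`, points of equal level `l` do not precede each other and the finite chains are the sets
`{(l₁, x₁), …, (lₙ, xₙ)}` with `l₁ < ⋯ < lₙ`.
-/

section Lexicographic

variable {X : Type u} {E : X → Type v}

/-- The family `𝓑_{(l,x)} = 𝓑_x` over `ℤ × X`. -/
def liftFamily (𝓑 : ∀ x, SigmaSemiring (E x)) (t : ℤ ×ₗ X) : SigmaSemiring (E (ofLex t).2) :=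
  𝓑 (ofLex t).2

/-- The action of `s ∈ ℤ` on `ℤ × X`, `(l, x) ↦ (l + s, x)`. -/
def shift (s : ℤ) (t : ℤ ×ₗ X) : ℤ ×ₗ X := toLex ((ofLex t).1 + s, (ofLex t).2)

/-- The sequence `t_i = (s_i, x_i)`. -/
def pairSeq {n : ℕ} (s : Fin n → ℤ) (x : Fin n → X) (i : Fin n) : ℤ ×ₗ X := toLex (s i, x i)

/-- Ultrastationarity: for a sequence `t₁ ≤ ⋯ ≤ tₙ` of points `t_i = (s_i, x_i)`,
repetitions being allowed, the multikernel `κ_x^s` depends only on `x = (x₁, …, xₙ)`. -/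
def IsUltrastationary [PartialOrder X] {𝓑 : ∀ x, SigmaSemiring (E x)}
    (κ : Multikernels (liftFamily 𝓑)) : Prop :=
  ∀ (n : ℕ) (x : Fin n → X) (s s' : Fin n → ℤ) (hs : Monotone (pairSeq s x))
    (hs' : Monotone (pairSeq s' x)) (B B' : ∀ i, (𝓑 (x i)).Event),
    κ.onSeq (pairSeq s x) hs B B' = κ.onSeq (pairSeq s' x) hs' B B'

/-- `S`-quasiconstancy for `S = ℤ`: `π_t(B) = π_{st}(B)`. -/
def IsQuasiconstant {𝓑 : ∀ x, SigmaSemiring (E x)} {H : Type w} [NormedAddCommGroup H]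
    [InnerProductSpace ℂ H] [CompleteSpace H] (P : NarrowQSP (liftFamily 𝓑) H) : Prop :=
  ∀ (s : ℤ) (t : ℤ ×ₗ X) (B : (𝓑 (ofLex t).2).Event), P.π t B = P.π (shift s t) B

/-- `Q` is the process `π_x = π_{(l,x)}`, `x ∈ X`, with the same state vector. -/
def IsReduction {𝓑 : ∀ x, SigmaSemiring (E x)} {H : Type w} [NormedAddCommGroup H]
    [InnerProductSpace ℂ H] [CompleteSpace H] (P : NarrowQSP (liftFamily 𝓑) H)
    (Q : NarrowQSP 𝓑 H) : Prop :=
  Q.ξ = P.ξ ∧ ∀ (t : ℤ ×ₗ X) (B : (𝓑 (ofLex t).2).Event), P.π t B = Q.π (ofLex t).2 B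

/-- The arbitrarily ordered correlation kernels `κ_x`, `x = (x₁, …, xₙ) ∈ Xⁿ`, of `Q` are the
multikernels `κ_x^s`:
`κ_x^s(B, B') = (π_{xₙ}(Bₙ) ⋯ π_{x₁}(B₁) ξ | π_{xₙ}(B'ₙ) ⋯ π_{x₁}(B'₁) ξ)`. -/
def HasOrderedKernels [PartialOrder X] {𝓑 : ∀ x, SigmaSemiring (E x)} {H : Type w}
    [NormedAddCommGroup H] [InnerProductSpace ℂ H] [CompleteSpace H] (Q : NarrowQSP 𝓑 H)
    (κ : Multikernels (liftFamily 𝓑)) : Prop :=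
  ∀ (n : ℕ) (x : Fin n → X) (s : Fin n → ℤ) (hs : Monotone (pairSeq s x))
    (B B' : ∀ i, (𝓑 (x i)).Event),
    κ.onSeq (pairSeq s x) hs B B' = ⟪Q.vec x B, Q.vec x B'⟫_ℂ

end Lexicographic

/-! Any finite sequence in `X`, in whatever order, becomes a chain in `ℤ × X` once it is given
increasing levels, and ultrastationarity makes the value of the kernels independent of the levels.
So `κ` amounts to a function `F` (`Multikernels.word`) of words of triples `(x, B, B')`. In such a
word sure letters can be dropped, and neighbouring letters at the same `x` can be multiplied, since
they may be put at one and the same level.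

`F` pairs only sequences of events over the same points, whereas a Hilbert space needs inner
products of words over different points. The crux is `IsWordKernel.swap`: a letter `(B, E)` and a
neighbouring letter `(E, C)` may be exchanged. Positivity forces this, because the vectors with `B`
just before and just after the place of `C` have zero distance. Hence `F` is determined by the
kernel `wordGram`, where one word acts on the left and then another on the right, and padding with
sure letters makes `wordGram` positive definite.

In its Hilbert space, appending a letter is symmetric by factorizability and idempotent by
multiplication of equal letters, so it is a projection. `σ`-additivity passes from the total family
to the whole space. Repeating these projections on every level gives the process.

A process is minimal exactly when the word vectors are total. Their Gram kernel is prescribed by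
`κ`, whence uniqueness. -/

/-! ### Positive definite kernels and their Hilbert spaces -/

section PosKernel

/-- A complex kernel on `W` is positive definite if all its finite sections are. -/
def PosKernel {W : Type u} (K : W → W → ℂ) : Prop :=
  ∀ (m : ℕ) (b : Fin m → W) (c : Fin m → ℂ), 0 ≤ ∑ i, ∑ j, K (b i) (b j) * conj (c i) * c j

theorem PosKernel.finsupp {W : Type u} {K : W → W → ℂ} (hK : PosKernel K) (f : W →₀ ℂ) :
    0 ≤ f.sum fun a z => f.sum fun b y => conj z * y * K a b := by
  classical
  have h := hK f.support.card (fun i => (f.support.equivFin.symm i).1)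
    (fun i => f (f.support.equivFin.symm i).1)
  have e : ∀ g : W → ℂ, ∑ i, g (f.support.equivFin.symm i).1 = ∑ a ∈ f.support, g a := by
    intro g
    rw [Equiv.sum_comp f.support.equivFin.symm (fun a => g a.1), Finset.sum_coe_sort]
  rw [e fun a => ∑ j, K a (f.support.equivFin.symm j).1 * conj (f a) *
    f (f.support.equivFin.symm j).1] at h
  simp only [Finsupp.sum]
  refine h.trans_eq (Finset.sum_congr rfl fun a _ => ?_)
  rw [e fun b => K a b * conj (f a) * f b]
  exact Finset.sum_congr rfl fun b _ => by ring

/-- Nonnegativity in `ℂ` includes a vanishing imaginary part. The diagonal is therefore real; the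
coefficients `(1, 1)` make the imaginary parts of `K a b` and `K b a` opposite, and `(1, i)` make
their real parts equal. -/
theorem PosKernel.conj_symm {W : Type u} {K : W → W → ℂ} (hK : PosKernel K) (a b : W) :
    conj (K b a) = K a b := by
  have ha := hK 1 ![a] ![1]
  have hb := hK 1 ![b] ![1]
  have h1 := hK 2 ![a, b] ![1, 1]
  have h2 := hK 2 ![a, b] ![1, Complex.I]
  simp [Fin.sum_univ_two, Complex.le_def] at ha hb h1 h2
  apply Complex.ext
  · simp; linarith [h2.2]
  · simp; linarith [h1.2]

/-- The pre-inner product on finitely supported functions given by a positive definite kernel. -/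
noncomputable abbrev PosKernel.core {W : Type u} {K : W → W → ℂ} (hK : PosKernel K) :
    PreInnerProductSpace.Core ℂ (W →₀ ℂ) where
  inner f g := f.sum fun a z => g.sum fun b y => conj z * y * K a b
  conj_inner_symm f g := by
    rw [Finsupp.sum_comm]
    simp only [map_finsuppSum, map_mul, hK.conj_symm]
    simp [mul_comm]
  re_inner_nonneg f := (Complex.le_def.1 (hK.finsupp f)).1
  add_left _ _ _ := by
    rw [Finsupp.sum_add_index'] <;> simp [← Finsupp.sum_add, add_mul]
  smul_left _ _ _ := by
    rw [Finsupp.sum_smul_index] <;> simp [Finsupp.mul_sum, ← mul_assoc]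

/-- A positive definite kernel is the Gram kernel of a total family in a Hilbert space. -/
theorem PosKernel.exists_hilbert {W : Type u} {K : W → W → ℂ} (hK : PosKernel K) :
    ∃ (H : Type u) (_ : NormedAddCommGroup H) (_ : InnerProductSpace ℂ H) (_ : CompleteSpace H)
      (φ : W → H), (∀ a b, ⟪φ a, φ b⟫_ℂ = K a b) ∧
        (Submodule.span ℂ (Set.range φ)).topologicalClosure = ⊤ := by
  let : PreInnerProductSpace.Core ℂ (W →₀ ℂ) := hK.core
  let i1 : SeminormedAddCommGroup (W →₀ ℂ) :=
    InnerProductSpace.Core.toSeminormedAddCommGroup (𝕜 := ℂ)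
  let i2 : InnerProductSpace ℂ (W →₀ ℂ) := .ofCore hK.core
  -- The completion of a seminormed space is separated, so null vectors are identified with zero
  -- without a prior quotient.
  refine ⟨UniformSpace.Completion (W →₀ ℂ), inferInstance, inferInstance, inferInstance,
    fun a => ((Finsupp.single a 1 : W →₀ ℂ) : UniformSpace.Completion (W →₀ ℂ)), ?_, ?_⟩
  · intro a b
    rw [UniformSpace.Completion.inner_coe]
    change (Finsupp.single a (1 : ℂ)).sum (fun a z => (Finsupp.single b (1 : ℂ)).sum
      fun b y => conj z * y * K a b) = _
    simp
  · rw [← Submodule.dense_iff_topologicalClosure_eq_top]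
    refine UniformSpace.Completion.denseRange_coe.mono ?_
    rintro _ ⟨f, rfl⟩
    induction f using Finsupp.induction_linear with
    | zero => exact Submodule.zero_mem _
    | add f g hf hg =>
      rw [UniformSpace.Completion.coe_add]
      exact Submodule.add_mem _ hf hg
    | single a z =>
      have : (Finsupp.single a z : W →₀ ℂ) = z • Finsupp.single a 1 := by simp
      rw [this, UniformSpace.Completion.coe_smul]
      exact Submodule.smul_mem _ _ (Submodule.subset_span ⟨a, rfl⟩)

/-- Two points between which a positive definite kernel does not distinguish on the diagonal are
not distinguished by it at all. -/
theorem PosKernel.eq_of_diag {W : Type u} {K : W → W → ℂ} (hK : PosKernel K) {a b : W}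
    (hab : K a b = K a a) (hbb : K b b = K a a) (c : W) : K a c = K b c := by
  obtain ⟨H, _, _, _, φ, hφ, -⟩ := hK.exists_hilbert
  have hba : K b a = K a a := by rw [← hK.conj_symm, hab, hK.conj_symm]
  have h : φ a - φ b = 0 := by
    rw [← inner_self_eq_zero (𝕜 := ℂ)]
    rw [inner_sub_left, inner_sub_right, inner_sub_right, hφ, hφ, hφ, hφ, hab, hbb, hba]
    simp
  rw [← hφ, ← hφ, sub_eq_zero.1 h]

end PosKernel

/-! ### Total families and their Gram kernels -/

section Total

variable {H : Type w} [NormedAddCommGroup H] [InnerProductSpace ℂ H]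
  {H' : Type w'} [NormedAddCommGroup H'] [InnerProductSpace ℂ H'] {W : Type u}

/-- Continuous linear maps that agree on a total family are equal. -/
theorem ContinuousLinearMap.ext_of_total {φ : W → H}
    (hφ : (Submodule.span ℂ (Set.range φ)).topologicalClosure = ⊤) {A B : H →L[ℂ] H'}
    (h : ∀ a, A (φ a) = B (φ a)) : A = B := by
  apply ContinuousLinearMap.ext_on (s := Set.range φ)
  · rwa [Submodule.dense_iff_topologicalClosure_eq_top]
  · rintro _ ⟨a, rfl⟩
    exact h a

/-- Total families with the same Gram kernel are unitarily equivalent. -/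
theorem exists_unitary_of_gram_eq [CompleteSpace H] [CompleteSpace H'] {φ : W → H} {ψ : W → H'}
    (hφ : (Submodule.span ℂ (Set.range φ)).topologicalClosure = ⊤)
    (hψ : (Submodule.span ℂ (Set.range ψ)).topologicalClosure = ⊤)
    (h : ∀ a b, ⟪φ a, φ b⟫_ℂ = ⟪ψ a, ψ b⟫_ℂ) : ∃ U : H ≃ₗᵢ[ℂ] H', ∀ a, U (φ a) = ψ a := by
  -- Equal Gram kernels give equal norms to linear combinations with the same coefficients, so the
  -- identity on coefficients descends to an isometry even if the families are linearly dependent.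
  have key : ∀ f : W →₀ ℂ,
      ‖Finsupp.linearCombination ℂ ψ f‖ = ‖Finsupp.linearCombination ℂ φ f‖ := by
    intro f
    rw [← sq_eq_sq₀ (norm_nonneg _) (norm_nonneg _), ← inner_self_eq_norm_sq (𝕜 := ℂ),
      ← inner_self_eq_norm_sq (𝕜 := ℂ)]
    simp only [Finsupp.linearCombination_apply, Finsupp.sum_inner, Finsupp.inner_sum,
      inner_smul_left, inner_smul_right, h]
  have dφ : DenseRange (Finsupp.linearCombination ℂ φ) := by
    rw [DenseRange, ← LinearMap.coe_range, Finsupp.range_linearCombination,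
      Submodule.dense_iff_topologicalClosure_eq_top, hφ]
  have dψ : DenseRange (Finsupp.linearCombination ℂ ψ) := by
    rw [DenseRange, ← LinearMap.coe_range, Finsupp.range_linearCombination,
      Submodule.dense_iff_topologicalClosure_eq_top, hψ]
  refine ⟨(LinearEquiv.refl ℂ (W →₀ ℂ)).extendOfIsometry (Finsupp.linearCombination ℂ φ)
    (Finsupp.linearCombination ℂ ψ) dφ dψ key, fun a => ?_⟩
  have := (LinearEquiv.refl ℂ (W →₀ ℂ)).extendOfIsometry_eq (Finsupp.linearCombination ℂ φ)
    (Finsupp.linearCombination ℂ ψ) dφ dψ key (Finsupp.single a 1)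
  simpa using this

end Total

/-! ### Strong resolutions of the identity -/

section Projections

variable {H : Type w} [NormedAddCommGroup H] [InnerProductSpace ℂ H] [CompleteSpace H]

/-- A finite sum of mutually orthogonal projections is a projection. -/
theorem isStarProjection_sum_of_orthogonal {p : ℕ → H →L[ℂ] H}
    (hp : ∀ m, IsStarProjection (p m)) (ho : Pairwise fun m m' => p m ∘L p m' = 0)
    (s : Finset ℕ) : IsStarProjection (∑ m ∈ s, p m) := by
  classical
  refine ⟨?_, ?_⟩
  · rw [IsIdempotentElem, Finset.sum_mul_sum]
    refine Finset.sum_congr rfl fun m hm => ?_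
    rw [Finset.sum_eq_single m]
    · exact (hp m).isIdempotentElem
    · intro k _ hk
      exact ho (Ne.symm hk)
    · exact fun h => absurd hm h
  · rw [IsSelfAdjoint, star_sum]
    exact Finset.sum_congr rfl fun m _ => (hp m).isSelfAdjoint

/-- Mutually orthogonal projections which resolve the identity in norm on a total family resolve
it strongly. -/
theorem hasSum_of_orthogonal_projections {W : Type u} {φ : W → H}
    (hφ : (Submodule.span ℂ (Set.range φ)).topologicalClosure = ⊤) {p : ℕ → H →L[ℂ] H}
    (hp : ∀ m, IsStarProjection (p m)) (ho : Pairwise fun m m' => p m ∘L p m' = 0)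
    (hs : ∀ a, HasSum (fun m => ⟪p m (φ a), p m (φ a)⟫_ℂ) ⟪φ a, φ a⟫_ℂ) (x : H) :
    HasSum (fun m => p m x) x := by
  have hS := isStarProjection_sum_of_orthogonal hp ho
  have proj_inner : ∀ q : H →L[ℂ] H, IsStarProjection q → ∀ y z, ⟪q y, q z⟫_ℂ = ⟪y, q z⟫_ℂ := by
    intro q hq y z
    rw [← ContinuousLinearMap.adjoint_inner_right]
    change ⟪y, ((star q) * q) z⟫_ℂ = _
    rw [hq.isSelfAdjoint.star_eq, hq.isIdempotentElem.eq]
  have gen : ∀ a, HasSum (fun m => p m (φ a)) (φ a) := by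
    intro a
    rw [HasSum, tendsto_iff_norm_sub_tendsto_zero]
    -- Pythagoras: the squared distance from the partial sum to `φ a` is the remainder of the scalar
    -- series.
    have h1 : ∀ s : Finset ℕ, ‖(∑ m ∈ s, p m (φ a)) - φ a‖ ^ 2
        = (⟪φ a, φ a⟫_ℂ - ∑ m ∈ s, ⟪p m (φ a), p m (φ a)⟫_ℂ).re := by
      intro s
      have e : ∑ m ∈ s, ⟪p m (φ a), p m (φ a)⟫_ℂ = ⟪φ a, (∑ m ∈ s, p m) (φ a)⟫_ℂ := by
        rw [sum_apply, inner_sum]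
        exact Finset.sum_congr rfl fun m _ => proj_inner _ (hp m) _ _
      have e' : ⟪(∑ m ∈ s, p m) (φ a), φ a⟫_ℂ = ⟪φ a, (∑ m ∈ s, p m) (φ a)⟫_ℂ := by
        rw [← proj_inner _ (hS s), ← inner_conj_symm, ← proj_inner _ (hS s), inner_conj_symm]
      rw [e, ← sum_apply, ← inner_self_eq_norm_sq (𝕜 := ℂ), inner_sub_left,
        inner_sub_right, inner_sub_right, proj_inner _ (hS s), e', sub_self,
        zero_sub, neg_sub]
      rfl
    have h2 : Filter.Tendsto (fun s : Finset ℕ => ‖(∑ m ∈ s, p m (φ a)) - φ a‖ ^ 2)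
        (SummationFilter.unconditional ℕ).filter (nhds 0) := by
      simp only [h1]
      have := (Complex.continuous_re.tendsto _).comp ((hs a).const_sub ⟪φ a, φ a⟫_ℂ)
      rwa [sub_self, Complex.zero_re] at this
    have h3 := (Real.continuous_sqrt.tendsto _).comp h2
    simpa [Function.comp_def, Real.sqrt_sq] using h3
  have lin : ∀ y ∈ Submodule.span ℂ (Set.range φ), HasSum (fun m => p m y) y := by
    intro y hy
    induction hy using Submodule.span_induction with
    | mem y hy =>
      obtain ⟨a, rfl⟩ := hy
      exact gen a
    | zero => simp
    | add y z _ _ hy hz => simpa using hy.add hz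
    | smul c y _ hy => simpa using hy.const_smul c
  have hd : Dense (Submodule.span ℂ (Set.range φ) : Set H) := by
    rwa [Submodule.dense_iff_topologicalClosure_eq_top]
  rw [HasSum, Metric.tendsto_nhds]
  intro ε hε
  obtain ⟨y, hy, hxy⟩ := Metric.dense_iff.1 hd x (ε / 3) (by positivity)
  rw [Metric.mem_ball, dist_eq_norm] at hy
  filter_upwards [Metric.tendsto_nhds.1 (lin y hxy) (ε / 3) (by positivity)] with s hs'
  rw [dist_eq_norm] at hs' ⊢
  -- Partial sums are projections, hence contractions; this uniform bound carries convergence from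
  -- the dense span to `x`.
  have hn : ‖∑ m ∈ s, p m (x - y)‖ ≤ ‖x - y‖ := by
    rw [← sum_apply]
    refine (ContinuousLinearMap.le_opNorm _ _).trans ?_
    exact mul_le_of_le_one_left (norm_nonneg _) (hS s).norm_le
  have e : (∑ m ∈ s, p m x) - x = ∑ m ∈ s, p m (x - y) + ((∑ m ∈ s, p m y) - y) + (y - x) := by
    simp only [map_sub, Finset.sum_sub_distrib]
    abel
  rw [e]
  have hyx := norm_sub_rev x y
  linarith [norm_add₃_le (a := ∑ m ∈ s, p m (x - y)) (b := (∑ m ∈ s, p m y) - y) (c := y - x)]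

end Projections

/-! ### Words and their kernels -/

section WordKernel

variable {X : Type u} {E : X → Type v}

/-- A letter is an event of some `𝓑_x`. -/
abbrev Letter (𝓑 : ∀ x, SigmaSemiring (E x)) : Type (max u v) := Σ x, (𝓑 x).Event

/-- A pair of events of the same `𝓑_x`. -/
abbrev LetterPair (𝓑 : ∀ x, SigmaSemiring (E x)) : Type (max u v) :=
  Σ x, (𝓑 x).Event × (𝓑 x).Event

/-- The word of the pairs `(B, B)`. -/
def diagWord {𝓑 : ∀ x, SigmaSemiring (E x)} (w : List (Letter 𝓑)) : List (LetterPair 𝓑) :=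
  w.map fun a => ⟨a.1, (a.2, a.2)⟩

/-- The properties of the arbitrarily ordered kernels `κ_x((B_i), (B'_i))`, regarded as a function
of the word of the triples `(x_i, B_i, B'_i)`. -/
structure IsWordKernel {𝓑 : ∀ x, SigmaSemiring (E x)} (F : List (LetterPair 𝓑) → ℂ) : Prop where
  nil : F [] = 1
  sure : ∀ u v x, F (u ++ ⟨x, ((𝓑 x).sure, (𝓑 x).sure)⟩ :: v) = F (u ++ v)
  merge : ∀ u v x (B B' C C' : (𝓑 x).Event), F (u ++ ⟨x, (B, B')⟩ :: ⟨x, (C, C')⟩ :: v) =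
    F (u ++ ⟨x, ((𝓑 x).mul B C, (𝓑 x).mul B' C')⟩ :: v)
  pos : ∀ (m : ℕ) (D : List (Σ x, Fin m → (𝓑 x).Event)),
    PosKernel fun i j => F (D.map fun a => ⟨a.1, (a.2 i, a.2 j)⟩)
  factor : ∀ u x (B B' C : (𝓑 x).Event),
    F (u ++ [⟨x, ((𝓑 x).mul B C, B')⟩]) = F (u ++ [⟨x, (B, (𝓑 x).mul B' C)⟩])
  sigma : ∀ (w : List (Letter 𝓑)) x (B : (𝓑 x).Event) (f : ℕ → (𝓑 x).Event),
    (𝓑 x).IsDisjointSum B f →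
      HasSum (fun m => F (diagWord (w ++ [⟨x, f m⟩]))) (F (diagWord (w ++ [⟨x, B⟩])))

end WordKernel

/-! ### Words with levels -/

section Levels

variable {X : Type u} {E : X → Type v} {𝓑 : ∀ x, SigmaSemiring (E x)}
  {α : X → Type w} {β : X → Type w'}

/-- The point of `ℤ × X` occupied by a letter with a level. -/
def levelPoint (a : ℤ × Σ x, α x) : ℤ ×ₗ X := toLex (a.1, a.2.1)

/-- The event at `t` which is the product of the events that a word assigns to `t`. -/
def totalEvent (f : ∀ x, α x → (𝓑 x).Event) (L : List (ℤ × Σ x, α x)) (t : ℤ ×ₗ X) :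
    (liftFamily 𝓑 t).Event :=
  ⟨{p | ∀ a : α (ofLex t).2, ((ofLex t).1, ⟨(ofLex t).2, a⟩) ∈ L → p ∈ (f _ a).1}, by
    induction L with
    | nil => simpa using (liftFamily 𝓑 t).univ_mem
    | cons c L ih =>
      by_cases h : ∃ a : α (ofLex t).2, ((ofLex t).1, (⟨(ofLex t).2, a⟩ : Σ x, α x)) = c
      · obtain ⟨a, rfl⟩ := h
        have e : {p : E (ofLex t).2 | ∀ b : α (ofLex t).2, ((ofLex t).1, ⟨(ofLex t).2, b⟩) ∈
            ((ofLex t).1, (⟨(ofLex t).2, a⟩ : Σ x, α x)) :: L → p ∈ (f _ b).1} = (f _ a).1 ∩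
              {p | ∀ b : α (ofLex t).2, ((ofLex t).1, ⟨(ofLex t).2, b⟩) ∈ L → p ∈ (f _ b).1} := by
          ext p
          simp [or_imp, forall_and]
        exact e ▸ (𝓑 _).inter_mem _ (f _ a).2 _ ih
      · convert ih using 3 with p
        refine forall_congr' fun a => ?_
        have : ((ofLex t).1, (⟨(ofLex t).2, a⟩ : Σ x, α x)) ≠ c := fun e => h ⟨a, e⟩
        simp [this]⟩

theorem mem_totalEvent {f : ∀ x, α x → (𝓑 x).Event} {L : List (ℤ × Σ x, α x)} {l : ℤ} {x : X}
    {p : E x} : p ∈ (totalEvent f L (toLex (l, x))).1 ↔ ∀ a, (l, ⟨x, a⟩) ∈ L → p ∈ (f x a).1 :=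
  Iff.rfl

theorem totalEvent_ext {f : ∀ x, α x → (𝓑 x).Event} {L : List (ℤ × Σ x, α x)}
    {g : ∀ x, β x → (𝓑 x).Event} {M : List (ℤ × Σ x, β x)} {l : ℤ} {x : X}
    (h : ∀ p : E x, (∀ a, (l, ⟨x, a⟩) ∈ L → p ∈ (f x a).1) ↔
      ∀ a, (l, ⟨x, a⟩) ∈ M → p ∈ (g x a).1) :
    totalEvent f L (toLex (l, x)) = totalEvent g M (toLex (l, x)) :=
  Subtype.ext (Set.ext h)

theorem totalEvent_eq_sure {f : ∀ x, α x → (𝓑 x).Event} {L : List (ℤ × Σ x, α x)} {t : ℤ ×ₗ X}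
    (h : ∀ a ∈ L, levelPoint a ≠ t) : totalEvent f L t = (liftFamily 𝓑 t).sure := by
  refine Subtype.ext (Set.eq_univ_of_forall fun p a ha => ?_)
  exact absurd rfl (h _ ha)

theorem totalEvent_map {f : ∀ x, β x → (𝓑 x).Event} (h : ∀ x, α x → β x)
    (L : List (ℤ × Σ x, α x)) (t : ℤ ×ₗ X) :
    totalEvent f (L.map fun a => (a.1, ⟨a.2.1, h _ a.2.2⟩)) t =
      totalEvent (fun x a => f x (h x a)) L t := by
  obtain ⟨l, x⟩ := t
  refine totalEvent_ext fun p => ⟨fun H a ha => ?_, fun H a ha => ?_⟩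
  · exact H _ (List.mem_map.2 ⟨_, ha, rfl⟩)
  · obtain ⟨⟨l', y, c⟩, hc, e⟩ := List.mem_map.1 ha
    cases e
    exact H _ hc

/-- Strictly increasing levels for a word. -/
def withLevels {A : Type w} : ℤ → List A → List (ℤ × A)
  | _, [] => []
  | l, a :: d => (l, a) :: withLevels (l + 1) d

theorem map_snd_withLevels {A : Type w} (l : ℤ) (d : List A) :
    (withLevels l d).map Prod.snd = d := by
  induction d generalizing l with
  | nil => rfl
  | cons a d ih => simp [withLevels, ih]

theorem le_of_mem_withLevels {A : Type w} {l : ℤ} {d : List A} :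
    ∀ a ∈ withLevels l d, l ≤ a.1 := by
  induction d generalizing l with
  | nil => simp [withLevels]
  | cons a d ih =>
    intro b hb
    rcases List.mem_cons.1 hb with rfl | hb
    · exact le_rfl
    · linarith [ih b hb]

theorem pairwise_withLevels {A : Type w} (l : ℤ) (d : List A) :
    (withLevels l d).Pairwise fun a b => a.1 < b.1 := by
  induction d generalizing l with
  | nil => exact List.Pairwise.nil
  | cons a d ih =>
    refine List.Pairwise.cons (fun b hb => ?_) (ih _)
    have := le_of_mem_withLevels b hb
    simp only
    linarith

variable [PartialOrder X]

/-- The sequence of the events `totalEvent` over a chain. -/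
def totalSeq (f : ∀ x, α x → (𝓑 x).Event) (L : List (ℤ × Σ x, α x)) (Λ : FinChain (ℤ ×ₗ X)) :
    EventSeq (liftFamily 𝓑) Λ :=
  fun t => totalEvent f L t.1

/-- The word runs through the points of `ℤ × X` in increasing order. -/
def IsSortedWord (L : List (ℤ × Σ x, α x)) : Prop :=
  L.Pairwise fun a b => levelPoint a ≤ levelPoint b

theorem levelPoint_lt_of_lt {a b : ℤ × Σ x, α x} (h : a.1 < b.1) : levelPoint a < levelPoint b :=
  Prod.Lex.left _ _ h

theorem isSortedWord_of_lt {L : List (ℤ × Σ x, α x)} (h : L.Pairwise fun a b => a.1 < b.1) :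
    IsSortedWord L :=
  h.imp fun hab => (levelPoint_lt_of_lt hab).le

open Classical in
/-- The chain of the points of a sorted word. -/
noncomputable def wordChain (L : List (ℤ × Σ x, α x)) (hL : IsSortedWord L) :
    FinChain (ℤ ×ₗ X) :=
  ⟨(L.map levelPoint).toFinset, by
    intro a ha b hb _
    simp only [List.coe_toFinset, List.mem_map, Set.mem_ofPred_eq] at ha hb
    obtain ⟨a, ha, rfl⟩ := ha
    obtain ⟨b, hb, rfl⟩ := hb
    have := List.Pairwise.forall_of_forall_of_flip
      (R := fun a b : ℤ × Σ x, α x => levelPoint a ≤ levelPoint b ∨ levelPoint b ≤ levelPoint a)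
      (fun _ _ => Or.inl le_rfl) (hL.imp fun h => Or.inl h) (hL.imp fun h => Or.inr h)
    exact this ha hb⟩

theorem mem_wordChain {L : List (ℤ × Σ x, α x)} {hL : IsSortedWord L} {t : ℤ ×ₗ X} :
    t ∈ (wordChain L hL).1 ↔ ∃ a ∈ L, levelPoint a = t := by
  classical
  simp [wordChain]

/-- The value of the kernels on a word with levels. -/
def Multikernels.onWord (κ : Multikernels (liftFamily 𝓑)) (Λ : FinChain (ℤ ×ₗ X))
    (f g : ∀ x, α x → (𝓑 x).Event) (L : List (ℤ × Σ x, α x)) : ℂ :=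
  κ Λ (totalSeq f L Λ) (totalSeq g L Λ)

variable {κ : Multikernels (liftFamily 𝓑)}

/-- A point carrying no letter has total event `E`, which is just what the extension inserts there.
-/
theorem extendSeq_totalSeq {f : ∀ x, α x → (𝓑 x).Event} {L : List (ℤ × Σ x, α x)}
    {Λ : FinChain (ℤ ×ₗ X)} (M : FinChain (ℤ ×ₗ X)) (hL : ∀ a ∈ L, levelPoint a ∈ Λ.1) :
    extendSeq M (totalSeq f L Λ) = totalSeq f L M := by
  funext t
  unfold extendSeq
  split_ifs with h
  · rfl
  · exact (totalEvent_eq_sure fun a ha e => h (by rw [← e]; exact hL a ha)).symm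

theorem Multikernels.onWord_mono (hproj : κ.IsProjective) {f g : ∀ x, α x → (𝓑 x).Event}
    {L : List (ℤ × Σ x, α x)} {Λ M : FinChain (ℤ ×ₗ X)} (hL : ∀ a ∈ L, levelPoint a ∈ Λ.1)
    (hM : Λ.1 ⊆ M.1) : κ.onWord Λ f g L = κ.onWord M f g L := by
  unfold onWord
  rw [hproj Λ M hM (totalSeq f L Λ) (totalSeq g L Λ), extendSeq_totalSeq M hL, extendSeq_totalSeq M hL]

/-- Two chains containing the points of `L` need not lie in a common chain, so both are compared
with the smallest one, the chain of `L` itself. -/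
theorem Multikernels.onWord_chain (hproj : κ.IsProjective) {f g : ∀ x, α x → (𝓑 x).Event}
    {L : List (ℤ × Σ x, α x)} (hs : IsSortedWord L) {Λ M : FinChain (ℤ ×ₗ X)}
    (hΛ : ∀ a ∈ L, levelPoint a ∈ Λ.1) (hM : ∀ a ∈ L, levelPoint a ∈ M.1) :
    κ.onWord Λ f g L = κ.onWord M f g L := by
  have h : ∀ N : FinChain (ℤ ×ₗ X), (∀ a ∈ L, levelPoint a ∈ N.1) →
      κ.onWord (wordChain L hs) f g L = κ.onWord N f g L := by
    intro N hN
    refine onWord_mono hproj (fun a ha => mem_wordChain.2 ⟨a, ha, rfl⟩) fun t ht => ?_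
    obtain ⟨a, ha, rfl⟩ := mem_wordChain.1 ht
    exact hN a ha
  rw [← h Λ hΛ, ← h M hM]

/-- Carries ultrastationarity, which speaks of `onSeq`, over to words. The casts in `seqOf`
disappear once an equality of points is split into its two coordinates. -/
theorem Multikernels.onSeq_eq_onWord {n : ℕ} (s : Fin n → ℤ) (x : Fin n → X)
    (hs : Monotone (pairSeq s x)) (B B' : ∀ i, (𝓑 (x i)).Event) :
    κ.onSeq (pairSeq s x) hs B B' =
      κ.onWord (chainOf (pairSeq s x) hs) (fun _ => Prod.fst) (fun _ => Prod.snd)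
        (List.ofFn fun i => (s i, (⟨x i, (B i, B' i)⟩ : LetterPair 𝓑))) := by
  have key : ∀ (C : ∀ i, (𝓑 (x i)).Event) (f : ∀ y, (𝓑 y).Event × (𝓑 y).Event → (𝓑 y).Event)
      (_ : ∀ i, f _ (B i, B' i) = C i),
      seqOf (𝓑 := liftFamily 𝓑) (pairSeq s x) hs C = totalSeq f
        (List.ofFn fun i => (s i, (⟨x i, (B i, B' i)⟩ : LetterPair 𝓑))) _ := by
    intro C f hf
    have aux : ∀ (l : ℤ) (y : X) (p : E y),
        (∀ i, ∀ h : toLex (l, y) = pairSeq s x i,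
          (h ▸ p : (fun t : ℤ ×ₗ X => E (ofLex t).2) (pairSeq s x i)) ∈ (C i).1) ↔
        ∀ a, (l, (⟨y, a⟩ : LetterPair 𝓑)) ∈ (List.ofFn fun i =>
          (s i, (⟨x i, (B i, B' i)⟩ : LetterPair 𝓑))) → p ∈ (f y a).1 := by
      intro l y p
      constructor
      · intro H a ha
        obtain ⟨i, hi⟩ := (List.mem_ofFn' _ _).1 ha
        cases hi
        rw [hf]
        exact H i rfl
      · intro H i h
        obtain ⟨rfl, rfl⟩ := Prod.mk.inj (toLex_inj.1 h)
        rw [← hf]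
        exact H _ ((List.mem_ofFn' _ _).2 ⟨i, rfl⟩)
    funext r
    obtain ⟨⟨l, y⟩, hr⟩ := r
    refine Subtype.ext (Set.ext fun p => ?_)
    refine Iff.trans ?_ (aux l y p)
    exact Set.mem_iInter
  unfold onSeq onWord
  rw [key B (fun _ => Prod.fst) fun _ => rfl, key B' (fun _ => Prod.snd) fun _ => rfl]

end Levels

/-! ### The kernels of arbitrarily ordered words -/

section OrderedKernels

variable {X : Type u} {E : X → Type v} {𝓑 : ∀ x, SigmaSemiring (E x)} {α : X → Type w}

theorem lt_of_mem_withLevels {A : Type w} {l : ℤ} {d : List A} :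
    ∀ a ∈ withLevels l d, a.1 < l + d.length := by
  induction d generalizing l with
  | nil => simp [withLevels]
  | cons a d ih =>
    intro b hb
    rcases List.mem_cons.1 hb with rfl | hb
    · simp
    · have := ih b hb
      push_cast [List.length_cons]
      linarith

/-- Puts two levellings of the same word over one index set, the form in which ultrastationarity
applies. -/
theorem exists_ofFn_of_map_snd_eq {A : Type w} {L L' : List (ℤ × A)}
    (h : L.map Prod.snd = L'.map Prod.snd) :
    ∃ (n : ℕ) (s s' : Fin n → ℤ) (g : Fin n → A),
      L = List.ofFn (fun i => (s i, g i)) ∧ L' = List.ofFn (fun i => (s' i, g i)) := by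
  have hl : L'.length = L.length := by simpa using (congrArg List.length h).symm
  refine ⟨L.length, fun i => L[i].1, fun i => L'[i.1].1, fun i => L[i].2, ?_, ?_⟩
  · exact List.ext_getElem (by simp) fun i _ _ => by simp
  · refine List.ext_getElem (by simp [hl]) fun i hi _ => ?_
    have hi' : i < L.length := hl ▸ hi
    have : (L.map Prod.snd)[i]'(by simpa using hi') = (L'.map Prod.snd)[i]'(by simpa using hi) := by
      simp [h]
    simp only [List.getElem_map] at this
    ext <;> simp [this]

theorem totalEvent_append_self {f : ∀ x, α x → (𝓑 x).Event} {L : List (ℤ × Σ x, α x)} {N : ℤ}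
    (hN : ∀ a ∈ L, a.1 < N) (x : X) (c : α x) :
    totalEvent f (L ++ [(N, ⟨x, c⟩)]) (toLex (N, x)) = f x c := by
  refine Subtype.ext (Set.ext fun p => ?_)
  refine mem_totalEvent.trans ⟨fun H => H c (by simp), fun H a ha => ?_⟩
  rcases List.mem_append.1 ha with ha | ha
  · exact absurd (hN _ ha) (lt_irrefl _)
  · cases List.mem_singleton.1 ha
    exact H

theorem totalEvent_append_of_ne {f : ∀ x, α x → (𝓑 x).Event} {L : List (ℤ × Σ x, α x)} {N : ℤ}
    {x : X} (c : α x) {t : ℤ ×ₗ X} (ht : t ≠ toLex (N, x)) :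
    totalEvent f (L ++ [(N, ⟨x, c⟩)]) t = totalEvent f L t := by
  obtain ⟨l, y⟩ := t
  refine totalEvent_ext fun p => forall_congr' fun a => ?_
  have : (l, (⟨y, a⟩ : Σ x, α x)) ≠ (N, ⟨x, c⟩) := by
    intro e
    cases e
    exact ht rfl
  rw [List.mem_append, List.mem_singleton, or_iff_left this]

variable [PartialOrder X]

theorem totalSeq_append_congr {f : ∀ x, α x → (𝓑 x).Event} {L : List (ℤ × Σ x, α x)} {N : ℤ}
    (hN : ∀ a ∈ L, a.1 < N) {x : X} {c c' : α x} (h : f x c = f x c') (Λ : FinChain (ℤ ×ₗ X)) :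
    totalSeq f (L ++ [(N, ⟨x, c⟩)]) Λ = totalSeq f (L ++ [(N, ⟨x, c'⟩)]) Λ := by
  funext t
  obtain ⟨t, ht⟩ := t
  change totalEvent _ _ t = totalEvent _ _ t
  by_cases e : t = toLex (N, x)
  · subst e
    rw [totalEvent_append_self hN, totalEvent_append_self hN, h]
  · rw [totalEvent_append_of_ne c e, totalEvent_append_of_ne c' e]

theorem mulAt_totalSeq_append {f : ∀ x, α x → (𝓑 x).Event} {L : List (ℤ × Σ x, α x)} {N : ℤ}
    (hN : ∀ a ∈ L, a.1 < N) {x : X} {c c' : α x} {C : (𝓑 x).Event}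
    (h : (𝓑 x).mul (f x c) C = f x c') (Λ : FinChain (ℤ ×ₗ X)) (ht : toLex (N, x) ∈ Λ.1) :
    mulAt (totalSeq f (L ++ [(N, ⟨x, c⟩)]) Λ) ⟨toLex (N, x), ht⟩ C =
      totalSeq f (L ++ [(N, ⟨x, c'⟩)]) Λ := by
  funext t
  unfold mulAt
  by_cases e : t = ⟨toLex (N, x), ht⟩
  · subst e
    refine (@Function.update_self _ _ (_) _ _ _).trans ?_
    exact ((congrArg ((𝓑 x).mul · C) (totalEvent_append_self hN x c)).trans h).trans
      (totalEvent_append_self hN x c').symm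
  · refine (@Function.update_of_ne _ _ (_) _ _ e _ _).trans ?_
    have e' : t.1 ≠ toLex (N, x) := fun h => e (Subtype.ext h)
    exact (totalEvent_append_of_ne c e').trans (totalEvent_append_of_ne c' e').symm

variable {κ : Multikernels (liftFamily 𝓑)}

theorem isSortedWord_ofFn {n : ℕ} {s : Fin n → ℤ} {g : Fin n → Σ x, α x} :
    IsSortedWord (List.ofFn fun i => (s i, g i)) ↔ Monotone (pairSeq s fun i => (g i).1) := by
  rw [IsSortedWord, List.pairwise_ofFn]
  refine ⟨fun h i j hij => ?_, fun h i j hij => h hij.le⟩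
  rcases hij.eq_or_lt with rfl | hij
  · exact le_rfl
  · exact h hij

/-- The kernel of a word of pairs of events, placed on increasing levels. -/
noncomputable def Multikernels.word (κ : Multikernels (liftFamily 𝓑)) (d : List (LetterPair 𝓑)) :
    ℂ :=
  κ.onWord (wordChain (withLevels 0 d) (isSortedWord_of_lt (pairwise_withLevels 0 d)))
    (fun _ => Prod.fst) (fun _ => Prod.snd) (withLevels 0 d)

/-- The kernel of a word does not depend on the levels. -/
theorem Multikernels.word_eq_onWord (hproj : κ.IsProjective) (h5 : IsUltrastationary κ)
    {L : List (ℤ × LetterPair 𝓑)} (hL : IsSortedWord L) {Λ : FinChain (ℤ ×ₗ X)}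
    (hΛ : ∀ a ∈ L, levelPoint a ∈ Λ.1) {d : List (LetterPair 𝓑)} (hd : L.map Prod.snd = d) :
    κ.word d = κ.onWord Λ (fun _ => Prod.fst) (fun _ => Prod.snd) L := by
  have hw := isSortedWord_of_lt (pairwise_withLevels 0 d)
  obtain ⟨M, hM, hMd⟩ : ∃ M : FinChain (ℤ ×ₗ X), (∀ a ∈ withLevels 0 d, levelPoint a ∈ M.1) ∧
      κ.word d = κ.onWord M (fun _ => Prod.fst) (fun _ => Prod.snd) (withLevels 0 d) :=
    ⟨wordChain _ hw, fun a ha => mem_wordChain.2 ⟨a, ha, rfl⟩, rfl⟩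
  obtain ⟨n, s, s', g, e, e'⟩ :=
    exists_ofFn_of_map_snd_eq ((map_snd_withLevels 0 d).trans hd.symm)
  have key : ∀ (s : Fin n → ℤ) (hs : IsSortedWord (List.ofFn fun i => (s i, g i)))
      (M : FinChain (ℤ ×ₗ X))
      (_ : ∀ a ∈ List.ofFn fun i => (s i, g i), levelPoint a ∈ M.1),
      κ.onWord M (fun _ => Prod.fst) (fun _ => Prod.snd) (List.ofFn fun i => (s i, g i)) =
        κ.onSeq (pairSeq s fun i => (g i).1) (isSortedWord_ofFn.1 hs) (fun i => (g i).2.1)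
          (fun i => (g i).2.2) := by
    intro s hs M hM
    rw [onSeq_eq_onWord]
    refine onWord_chain hproj hs hM fun a ha => ?_
    obtain ⟨i, rfl⟩ := (List.mem_ofFn' _ _).1 ha
    simp only [chainOf, Finset.mem_image, Finset.mem_univ, true_and]
    exact ⟨i, rfl⟩
  rw [e'] at hL hΛ
  rw [e] at hw hM
  rw [hMd, e, e', key s hw _ hM, key s' hL _ hΛ]
  exact h5 n _ _ _ _ _ _ _

/-- Reduces relations between words to a pointwise check: on the chain of `L` both words can be
evaluated, and there the kernel sees only the product of the events at each point. -/
theorem Multikernels.word_eq_of_totalEvent (hproj : κ.IsProjective) (h5 : IsUltrastationary κ)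
    {L L' : List (ℤ × LetterPair 𝓑)} (hL : IsSortedWord L) (hL' : IsSortedWord L')
    (hs : ∀ a ∈ L', ∃ b ∈ L, levelPoint b = levelPoint a)
    (h1 : ∀ t, totalEvent (𝓑 := 𝓑) (fun _ => Prod.fst) L t =
      totalEvent (fun _ => Prod.fst) L' t)
    (h2 : ∀ t, totalEvent (𝓑 := 𝓑) (fun _ => Prod.snd) L t =
      totalEvent (fun _ => Prod.snd) L' t) :
    κ.word (L.map Prod.snd) = κ.word (L'.map Prod.snd) := by
  rw [word_eq_onWord hproj h5 hL (Λ := wordChain L hL)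
      (fun a ha => mem_wordChain.2 ⟨a, ha, rfl⟩) rfl,
    word_eq_onWord hproj h5 hL' (Λ := wordChain L hL)
      (fun a ha => mem_wordChain.2 (hs a ha)) rfl]
  unfold onWord
  congr 1
  · exact funext fun t => h1 t
  · exact funext fun t => h2 t

/-- A chain with largest point `(N, x)` on which the kernels of all words extending a given one by
a letter at `x` can be evaluated. -/
theorem Multikernels.exists_chain_last (hproj : κ.IsProjective) (h5 : IsUltrastationary κ)
    (u : List (LetterPair 𝓑)) (x : X) :
    ∃ (L : List (ℤ × LetterPair 𝓑)) (N : ℤ) (Λ : FinChain (ℤ ×ₗ X)) (ht : toLex (N, x) ∈ Λ.1),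
      L.map Prod.snd = u ∧ (∀ a ∈ L, a.1 < N) ∧
      (∀ r : Λ.1, r ≤ ⟨toLex (N, x), ht⟩) ∧
      ∀ c, κ.word (u ++ [⟨x, c⟩]) =
        κ.onWord Λ (fun _ => Prod.fst) (fun _ => Prod.snd) (L ++ [(N, ⟨x, c⟩)]) := by
  have hN : ∀ a ∈ withLevels 0 u, a.1 < (0 + u.length : ℤ) := lt_of_mem_withLevels
  have hs : ∀ c, IsSortedWord (withLevels 0 u ++ [((0 + u.length : ℤ), (⟨x, c⟩ : LetterPair 𝓑))]) := by
    intro c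
    apply isSortedWord_of_lt
    rw [List.pairwise_append]
    refine ⟨pairwise_withLevels _ _, List.pairwise_singleton _ _, fun a ha b hb => ?_⟩
    rw [List.mem_singleton.1 hb]
    exact hN a ha
  have hmem : ∀ t, t ∈ (wordChain _ (hs ((𝓑 x).sure, (𝓑 x).sure))).1 ↔
      (∃ a ∈ withLevels 0 u, levelPoint a = t) ∨ t = toLex ((0 + u.length : ℤ), x) := by
    intro t
    rw [mem_wordChain]
    simp only [List.mem_append, List.mem_singleton, or_and_right, exists_or, exists_eq_left]
    exact or_congr_right eq_comm
  refine ⟨withLevels 0 u, 0 + u.length, wordChain _ (hs ((𝓑 x).sure, (𝓑 x).sure)),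
    (hmem _).2 (Or.inr rfl), map_snd_withLevels _ _, hN, ?_, fun c => ?_⟩
  · rintro ⟨r, hr⟩
    rcases (hmem r).1 hr with ⟨a, ha, rfl⟩ | rfl
    · exact (levelPoint_lt_of_lt (b := ((0 + u.length : ℤ), (⟨x, ((𝓑 x).sure, (𝓑 x).sure)⟩ :
        LetterPair 𝓑))) (hN a ha)).le
    · exact le_rfl
  · refine word_eq_onWord hproj h5 (hs c) (fun a ha => ?_) (by simp [map_snd_withLevels])
    rw [hmem]
    rcases List.mem_append.1 ha with ha | ha
    · exact Or.inl ⟨a, ha, rfl⟩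
    · rw [List.mem_singleton.1 ha]
      exact Or.inr rfl

/-! ### The axioms of a word kernel -/

theorem Multikernels.word_nil (h2 : κ.IsNormalized) :
    κ.word [] = 1 := by
  rw [← h2 (wordChain (withLevels 0 ([] : List (LetterPair 𝓑)))
    (isSortedWord_of_lt (pairwise_withLevels 0 _)))]
  unfold word onWord
  congr 1 <;> exact funext fun t => totalEvent_eq_sure (by simp [withLevels])

theorem Multikernels.word_sure (hproj : κ.IsProjective) (h5 : IsUltrastationary κ)
    (u v : List (LetterPair 𝓑)) (x : X) :
    κ.word (u ++ ⟨x, ((𝓑 x).sure, (𝓑 x).sure)⟩ :: v) = κ.word (u ++ v) := by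
  have hs := isSortedWord_of_lt
    (pairwise_withLevels 0 (u ++ ⟨x, ((𝓑 x).sure, (𝓑 x).sure)⟩ :: v : List (LetterPair 𝓑)))
  have hm := map_snd_withLevels 0
    (u ++ ⟨x, ((𝓑 x).sure, (𝓑 x).sure)⟩ :: v : List (LetterPair 𝓑))
  obtain ⟨Lu, L', e, rfl, h'⟩ := List.map_eq_append_iff.1 hm
  obtain ⟨⟨l, a⟩, Lv, rfl, ha, rfl⟩ := List.map_eq_cons_iff.1 h'
  simp only at ha
  subst ha
  rw [e] at hs hm
  have hsub : (Lu ++ Lv).Sublist (Lu ++ (l, ⟨x, ((𝓑 x).sure, (𝓑 x).sure)⟩) :: Lv) :=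
    (List.Sublist.refl Lu).append (List.sublist_cons_self _ _)
  rw [← hm, ← List.map_append]
  have aux : ∀ f : ∀ y, (𝓑 y).Event × (𝓑 y).Event → (𝓑 y).Event,
      (∀ y, f y ((𝓑 y).sure, (𝓑 y).sure) = (𝓑 y).sure) → ∀ t,
      totalEvent f (Lu ++ (l, ⟨x, ((𝓑 x).sure, (𝓑 x).sure)⟩) :: Lv) t =
        totalEvent f (Lu ++ Lv) t := by
    rintro f hf ⟨k, y⟩
    refine totalEvent_ext fun p => ⟨fun H a ha => H a (hsub.subset ha), fun H a ha => ?_⟩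
    rcases List.mem_append.1 ha with ha | ha
    · exact H a (List.mem_append_left _ ha)
    rcases List.mem_cons.1 ha with ha | ha
    · cases ha
      rw [hf]
      trivial
    · exact H a (List.mem_append_right _ ha)
  refine word_eq_of_totalEvent hproj h5 hs (hs.sublist hsub)
    (fun a ha => ⟨a, hsub.subset ha, rfl⟩) (aux _ fun _ => rfl) (aux _ fun _ => rfl)

/-- The letters `(B, B')` and `(C, C')` are both put at the level `l` of the merged letter, which is
legitimate because ultrastationarity admits repetitions. The total event at `(l, x)` is then the
product. -/
theorem Multikernels.word_merge (hproj : κ.IsProjective) (h5 : IsUltrastationary κ)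
    (u v : List (LetterPair 𝓑)) (x : X) (B B' C C' : (𝓑 x).Event) :
    κ.word (u ++ ⟨x, (B, B')⟩ :: ⟨x, (C, C')⟩ :: v) =
      κ.word (u ++ ⟨x, ((𝓑 x).mul B C, (𝓑 x).mul B' C')⟩ :: v) := by
  have hs := isSortedWord_of_lt (pairwise_withLevels 0
    (u ++ ⟨x, ((𝓑 x).mul B C, (𝓑 x).mul B' C')⟩ :: v : List (LetterPair 𝓑)))
  have hm := map_snd_withLevels 0
    (u ++ ⟨x, ((𝓑 x).mul B C, (𝓑 x).mul B' C')⟩ :: v : List (LetterPair 𝓑))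
  obtain ⟨Lu, L', e, rfl, h'⟩ := List.map_eq_append_iff.1 hm
  obtain ⟨⟨l, a⟩, Lv, rfl, ha, rfl⟩ := List.map_eq_cons_iff.1 h'
  simp only at ha
  subst ha
  rw [e] at hs hm
  have hs' : IsSortedWord (Lu ++ (l, (⟨x, (B, B')⟩ : LetterPair 𝓑)) ::
      (l, ⟨x, (C, C')⟩) :: Lv) := by
    rw [IsSortedWord, List.pairwise_append, List.pairwise_cons] at hs ⊢
    obtain ⟨q1, ⟨q2, q3⟩, q4⟩ := hs
    refine ⟨q1, ⟨?_, List.pairwise_cons.2 ⟨q2, q3⟩⟩, ?_⟩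
    · intro b hb
      rcases List.mem_cons.1 hb with rfl | hb
      · exact le_rfl
      · exact q2 b hb
    · intro a ha b hb
      rcases List.mem_cons.1 hb with rfl | hb
      · exact q4 a ha (l, ⟨x, ((𝓑 x).mul B C, (𝓑 x).mul B' C')⟩) List.mem_cons_self
      rcases List.mem_cons.1 hb with rfl | hb
      · exact q4 a ha (l, ⟨x, ((𝓑 x).mul B C, (𝓑 x).mul B' C')⟩) List.mem_cons_self
      · exact q4 a ha _ (List.mem_cons_of_mem _ hb)
  have aux : ∀ f : ∀ y, (𝓑 y).Event × (𝓑 y).Event → (𝓑 y).Event,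
      (f x ((𝓑 x).mul B C, (𝓑 x).mul B' C') = (𝓑 x).mul (f x (B, B')) (f x (C, C'))) → ∀ t,
      totalEvent f (Lu ++ (l, ⟨x, (B, B')⟩) :: (l, ⟨x, (C, C')⟩) :: Lv) t =
        totalEvent f (Lu ++ (l, ⟨x, ((𝓑 x).mul B C, (𝓑 x).mul B' C')⟩) :: Lv) t := by
    rintro f hf ⟨k, y⟩
    refine totalEvent_ext fun p => ⟨fun H a ha => ?_, fun H a ha => ?_⟩
    · rcases List.mem_append.1 ha with ha | ha
      · exact H a (List.mem_append_left _ ha)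
      rcases List.mem_cons.1 ha with ha | ha
      · cases ha
        rw [hf]
        exact ⟨H _ (by simp), H _ (by simp)⟩
      · exact H a (by simp [ha])
    · rcases List.mem_append.1 ha with ha | ha
      · exact H a (List.mem_append_left _ ha)
      rcases List.mem_cons.1 ha with ha | ha
      · cases ha
        have := H ((𝓑 x).mul B C, (𝓑 x).mul B' C') (by simp)
        rw [hf] at this
        exact this.1
      rcases List.mem_cons.1 ha with ha | ha
      · cases ha
        have := H ((𝓑 x).mul B C, (𝓑 x).mul B' C') (by simp)
        rw [hf] at this
        exact this.2
      · exact H a (by simp [ha])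
  have := word_eq_of_totalEvent hproj h5 hs' hs ?_ (aux _ rfl) (aux _ rfl)
  · simpa using this
  · intro a ha
    rcases List.mem_append.1 ha with ha | ha
    · exact ⟨a, List.mem_append_left _ ha, rfl⟩
    rcases List.mem_cons.1 ha with rfl | ha
    · exact ⟨(l, ⟨x, (B, B')⟩), by simp, rfl⟩
    · exact ⟨a, by simp [ha], rfl⟩

/-- All the words in question have the same points, so the same levels place them on one chain,
where positivity of `κ` applies. -/
theorem Multikernels.word_pos (hproj : κ.IsProjective) (h1 : κ.IsPositive)
    (h5 : IsUltrastationary κ) (m : ℕ) (D : List (Σ x, Fin m → (𝓑 x).Event)) :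
    PosKernel fun i j => κ.word (D.map fun a => ⟨a.1, (a.2 i, a.2 j)⟩) := by
  have hs := isSortedWord_of_lt (pairwise_withLevels 0 D)
  have key : ∀ i j, κ.word (D.map fun a => ⟨a.1, (a.2 i, a.2 j)⟩) =
      κ (wordChain _ hs) (totalSeq (fun _ b => b i) (withLevels 0 D) _)
        (totalSeq (fun _ b => b j) (withLevels 0 D) _) := by
    intro i j
    rw [word_eq_onWord hproj h5 (L := (withLevels 0 D).map fun a =>
      (a.1, ⟨a.2.1, (a.2.2 i, a.2.2 j)⟩)) (Λ := wordChain _ hs)]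
    · unfold onWord
      congr 1
      · exact funext fun t => totalEvent_map (α := fun x => Fin m → (𝓑 x).Event)
          (fun _ b => (b i, b j)) _ _
      · exact funext fun t => totalEvent_map (α := fun x => Fin m → (𝓑 x).Event)
          (fun _ b => (b i, b j)) _ _
    · exact List.pairwise_map.2 hs
    · intro a ha
      obtain ⟨b, hb, rfl⟩ := List.mem_map.1 ha
      exact mem_wordChain.2 ⟨b, hb, rfl⟩
    · conv_rhs => rw [← map_snd_withLevels 0 D]
      simp
  intro n b c
  refine (h1 (wordChain _ hs) n
    (fun i => totalSeq (fun _ e => e (b i)) (withLevels 0 D) _) c).trans_eq ?_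
  refine Finset.sum_congr rfl fun i _ => Finset.sum_congr rfl fun j _ => ?_
  exact congrArg (· * conj (c i) * c j) (key _ _).symm

theorem Multikernels.word_factor (hproj : κ.IsProjective) (h4 : κ.IsFactorizable)
    (h5 : IsUltrastationary κ) (u : List (LetterPair 𝓑)) (x : X) (B B' C : (𝓑 x).Event) :
    κ.word (u ++ [⟨x, ((𝓑 x).mul B C, B')⟩]) = κ.word (u ++ [⟨x, (B, (𝓑 x).mul B' C)⟩]) := by
  obtain ⟨L, N, Λ, ht, -, hN, hmax, hw⟩ := exists_chain_last hproj h5 u x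
  rw [hw, hw]
  have := h4 Λ ⟨toLex (N, x), ht⟩ hmax
    (totalSeq (fun _ => Prod.fst) (L ++ [(N, ⟨x, (B, B')⟩)]) Λ)
    (totalSeq (fun _ => Prod.snd) (L ++ [(N, ⟨x, (B, B')⟩)]) Λ) C
  rw [mulAt_totalSeq_append hN (c' := ((𝓑 x).mul B C, B')) rfl,
    mulAt_totalSeq_append hN (c' := (B, (𝓑 x).mul B' C)) rfl] at this
  rw [onWord, onWord, totalSeq_append_congr (f := fun _ => Prod.snd) hN
    (c' := (B, B')) (c := ((𝓑 x).mul B C, B')) rfl, this]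
  rw [totalSeq_append_congr (f := fun _ => Prod.fst) hN
    (c' := (B, B')) (c := (B, (𝓑 x).mul B' C)) rfl]

theorem Multikernels.word_sigma (hproj : κ.IsProjective) (h3 : κ.IsSigmaAdditive)
    (h5 : IsUltrastationary κ) (w : List (Letter 𝓑)) (x : X) (B : (𝓑 x).Event)
    (f : ℕ → (𝓑 x).Event) (hf : (𝓑 x).IsDisjointSum B f) :
    HasSum (fun m => κ.word (diagWord (w ++ [⟨x, f m⟩]))) (κ.word (diagWord (w ++ [⟨x, B⟩]))) := by
  obtain ⟨L, N, Λ, ht, hu, hN, hmax, hw⟩ := exists_chain_last hproj h5 (diagWord w) x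
  have hdiag : ∀ C, diagWord (w ++ [⟨x, C⟩]) = diagWord w ++ [⟨x, (C, C)⟩] := by
    intro C
    simp [diagWord]
  -- All letters are diagonal, so both arguments of `κ` coincide, as `σ`-additivity requires.
  have hLdiag : ∀ a ∈ L, a.2.2.1 = a.2.2.2 := by
    intro a ha
    have : a.2 ∈ diagWord w := hu ▸ List.mem_map_of_mem ha
    obtain ⟨b, -, hb⟩ := List.mem_map.1 this
    rw [← hb]
  have key : ∀ C, κ.word (diagWord (w ++ [⟨x, C⟩])) =
      κ Λ (totalSeq (fun _ => Prod.fst) (L ++ [(N, ⟨x, (C, C)⟩)]) Λ)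
        (totalSeq (fun _ => Prod.fst) (L ++ [(N, ⟨x, (C, C)⟩)]) Λ) := by
    intro C
    rw [hdiag, hw, onWord]
    congr 1
    funext t
    obtain ⟨⟨l, y⟩, _⟩ := t
    refine totalEvent_ext fun p => forall₂_congr fun a ha => ?_
    have : a.1 = a.2 := by
      rcases List.mem_append.1 ha with ha | ha
      · exact hLdiag _ ha
      · cases List.mem_singleton.1 ha
        rfl
    rw [this]
  simp only [key]
  refine h3 Λ ⟨toLex (N, x), ht⟩ hmax _ _ ?_ ?_
  · intro m r hr
    have hr' : r.1 ≠ toLex (N, x) := fun e => hr (Subtype.ext e)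
    exact (totalEvent_append_of_ne _ hr').trans (totalEvent_append_of_ne _ hr').symm
  · have e : ∀ C : (𝓑 x).Event, totalSeq (𝓑 := 𝓑) (fun _ => Prod.fst)
        (L ++ [(N, ⟨x, (C, C)⟩)]) Λ ⟨toLex (N, x), ht⟩ = C :=
      fun C => totalEvent_append_self hN x (C, C)
    simp only [e]
    exact hf

/-- The kernels of arbitrarily ordered words form a word kernel. -/
theorem Multikernels.isWordKernel_word (hproj : κ.IsProjective) (h1 : κ.IsPositive)
    (h2 : κ.IsNormalized) (h3 : κ.IsSigmaAdditive) (h4 : κ.IsFactorizable)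
    (h5 : IsUltrastationary κ) : IsWordKernel κ.word where
  nil := word_nil h2
  sure := word_sure hproj h5
  merge := word_merge hproj h5
  pos := word_pos hproj h1 h5
  factor := word_factor hproj h4 h5
  sigma := word_sigma hproj h3 h5

end OrderedKernels

/-! ### The Gram kernel of words -/

section Gram

variable {X : Type u} {E : X → Type v} {𝓑 : ∀ x, SigmaSemiring (E x)}

theorem SigmaSemiring.mul_sure {E : Type v} (𝓑 : SigmaSemiring E) (B : 𝓑.Event) :
    𝓑.mul B 𝓑.sure = B :=
  Subtype.ext (Set.inter_univ _)

theorem SigmaSemiring.sure_mul {E : Type v} (𝓑 : SigmaSemiring E) (B : 𝓑.Event) :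
    𝓑.mul 𝓑.sure B = B :=
  Subtype.ext (Set.univ_inter _)

theorem SigmaSemiring.mul_self {E : Type v} (𝓑 : SigmaSemiring E) (B : 𝓑.Event) :
    𝓑.mul B B = B :=
  Subtype.ext (Set.inter_self _)

/-- The pair `(B, E)`. -/
def leftLetter (a : Letter 𝓑) : LetterPair 𝓑 := ⟨a.1, (a.2, (𝓑 a.1).sure)⟩

/-- The pair `(E, B)`. -/
def rightLetter (a : Letter 𝓑) : LetterPair 𝓑 := ⟨a.1, ((𝓑 a.1).sure, a.2)⟩

/-- The kernel `(w, w')` of two words, of possibly different types. -/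
def wordGram (F : List (LetterPair 𝓑) → ℂ) (w w' : List (Letter 𝓑)) : ℂ :=
  F (w.map leftLetter ++ w'.map rightLetter)

open Classical in
/-- The word without its sure letters. -/
noncomputable def stripSure (w : List (Letter 𝓑)) : List (Letter 𝓑) :=
  w.filter fun a => a.2 ≠ (𝓑 a.1).sure

namespace IsWordKernel

variable {F : List (LetterPair 𝓑) → ℂ}

/-- Consider three sequences over the same points: `B` before the place of `C`, `B` after it, and
`C` alone. In the correlations of the first two with themselves and each other that place holds only
sure events, so merging gives the same value each time. By `PosKernel.eq_of_diag` they cannot be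
distinguished by the third, and this is the exchange. -/
theorem swap (hF : IsWordKernel F) (p r : List (LetterPair 𝓑)) (a b : Letter 𝓑) :
    F (p ++ leftLetter a :: rightLetter b :: r) = F (p ++ rightLetter b :: leftLetter a :: r) := by
  obtain ⟨x, B⟩ := a
  obtain ⟨y, C⟩ := b
  have sure₁ : ∀ u v a x, F (u ++ a :: ⟨x, ((𝓑 x).sure, (𝓑 x).sure)⟩ :: v) = F (u ++ a :: v) := by
    intro u v a x
    simpa using hF.sure (u ++ [a]) v x
  have sure₂ : ∀ u v a b x,
      F (u ++ a :: b :: ⟨x, ((𝓑 x).sure, (𝓑 x).sure)⟩ :: v) = F (u ++ a :: b :: v) := by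
    intro u v a b x
    simpa using hF.sure (u ++ [a, b]) v x
  -- In the context `p`, `r` the first two sequences take the left events and the third takes the
  -- right events.
  let row : LetterPair 𝓑 → Σ x, Fin 3 → (𝓑 x).Event := fun a => ⟨a.1, ![a.2.1, a.2.1, a.2.2]⟩
  have hpos := hF.pos 3 (p.map row ++ ⟨x, ![B, (𝓑 x).sure, (𝓑 x).sure]⟩ ::
    ⟨y, ![(𝓑 y).sure, (𝓑 y).sure, C]⟩ :: ⟨x, ![(𝓑 x).sure, B, (𝓑 x).sure]⟩ :: r.map row)
  have h := hpos.eq_of_diag (a := 0) (b := 1) ?_ ?_ 2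
  · simpa [row, Function.comp_def, leftLetter, rightLetter, sure₂, hF.sure] using h
  · simp [sure₁, hF.merge, SigmaSemiring.mul_sure, SigmaSemiring.sure_mul, row,
      Function.comp_def]
  · simp [sure₁, hF.sure, row, Function.comp_def]

theorem right_past_left (hF : IsWordKernel F) (p r : List (LetterPair 𝓑)) (b : Letter 𝓑)
    (w : List (Letter 𝓑)) :
    F (p ++ rightLetter b :: (w.map leftLetter ++ r)) =
      F (p ++ (w.map leftLetter ++ rightLetter b :: r)) := by
  induction w generalizing p with
  | nil => rfl
  | cons a w ih =>
    have := ih (p ++ [leftLetter a])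
    simp only [List.append_assoc, List.singleton_append] at this
    rw [List.map_cons, List.cons_append, ← hF.swap, this, List.cons_append]

theorem left_past_right (hF : IsWordKernel F) (p r : List (LetterPair 𝓑)) (b : Letter 𝓑)
    (w : List (Letter 𝓑)) :
    F (p ++ leftLetter b :: (w.map rightLetter ++ r)) =
      F (p ++ (w.map rightLetter ++ leftLetter b :: r)) := by
  induction w generalizing p with
  | nil => rfl
  | cons a w ih =>
    have := ih (p ++ [rightLetter a])
    simp only [List.append_assoc, List.singleton_append] at this
    rw [List.map_cons, List.cons_append, hF.swap, this, List.cons_append]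

/-- Each pair is a product `(B, B') = (B, E)(E, B')`; the right factors are then moved past all
later left factors. -/
theorem append_eq_split (hF : IsWordKernel F) (p d : List (LetterPair 𝓑)) :
    F (p ++ d) = F (p ++ ((d.map fun a => leftLetter ⟨a.1, a.2.1⟩) ++
      d.map fun a => rightLetter ⟨a.1, a.2.2⟩)) := by
  induction d generalizing p with
  | nil => rfl
  | cons a d ih =>
    obtain ⟨x, B, B'⟩ := a
    have h1 := hF.merge p d x B (𝓑 x).sure (𝓑 x).sure B'
    rw [SigmaSemiring.mul_sure, SigmaSemiring.sure_mul] at h1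
    have h2 := ih (p ++ [leftLetter ⟨x, B⟩, rightLetter ⟨x, B'⟩])
    have h3 := hF.right_past_left (p ++ [leftLetter ⟨x, B⟩])
      (d.map fun a => rightLetter ⟨a.1, a.2.2⟩) ⟨x, B'⟩ (d.map fun a => ⟨a.1, a.2.1⟩)
    simp only [List.append_assoc, List.cons_append, List.nil_append, List.map_map,
      Function.comp_def] at h2 h3
    rw [← h1, List.map_cons, List.map_cons, List.cons_append, ← h3, ← h2]
    rfl

theorem eq_wordGram (hF : IsWordKernel F) (d : List (LetterPair 𝓑)) :
    F d = wordGram F (d.map fun a => ⟨a.1, a.2.1⟩) (d.map fun a => ⟨a.1, a.2.2⟩) := by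
  have := hF.append_eq_split [] d
  simpa [wordGram, Function.comp_def] using this

theorem stripSure_left (hF : IsWordKernel F) (p r : List (LetterPair 𝓑)) (w : List (Letter 𝓑)) :
    F (p ++ ((stripSure w).map leftLetter ++ r)) = F (p ++ (w.map leftLetter ++ r)) := by
  induction w generalizing p with
  | nil => rfl
  | cons a w ih =>
    by_cases h : a.2 = (𝓑 a.1).sure
    · have e : leftLetter a = ⟨a.1, ((𝓑 a.1).sure, (𝓑 a.1).sure)⟩ := by rw [leftLetter, h]
      have e' : stripSure (a :: w) = stripSure w := by simp [stripSure, h]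
      rw [e', ih, List.map_cons, List.cons_append, e, hF.sure]
    · have e' : stripSure (a :: w) = a :: stripSure w := by simp [stripSure, h]
      have := ih (p ++ [leftLetter a])
      rw [e']
      simpa using this

theorem stripSure_right (hF : IsWordKernel F) (p r : List (LetterPair 𝓑)) (w : List (Letter 𝓑)) :
    F (p ++ ((stripSure w).map rightLetter ++ r)) = F (p ++ (w.map rightLetter ++ r)) := by
  induction w generalizing p with
  | nil => rfl
  | cons a w ih =>
    by_cases h : a.2 = (𝓑 a.1).sure
    · have e : rightLetter a = ⟨a.1, ((𝓑 a.1).sure, (𝓑 a.1).sure)⟩ := by rw [rightLetter, h]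
      have e' : stripSure (a :: w) = stripSure w := by simp [stripSure, h]
      rw [e', ih, List.map_cons, List.cons_append, e, hF.sure]
    · have e' : stripSure (a :: w) = a :: stripSure w := by simp [stripSure, h]
      have := ih (p ++ [rightLetter a])
      rw [e']
      simpa using this

theorem wordGram_stripSure (hF : IsWordKernel F) (w w' : List (Letter 𝓑)) :
    wordGram F (stripSure w) (stripSure w') = wordGram F w w' := by
  unfold wordGram
  have h1 := hF.stripSure_left [] ((stripSure w').map rightLetter) w
  have h2 := hF.stripSure_right (w.map leftLetter) [] w'
  simp only [List.nil_append, List.append_nil] at h1 h2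
  rw [h1, h2]

end IsWordKernel

theorem List.flatMap_ite_eq {A : Type u} {B : Type v} [DecidableEq A] (g : A → List B) (i : A) :
    ∀ l : List A, l.Nodup →
      l.flatMap (fun k => if i = k then g k else []) = if i ∈ l then g i else [] := by
  intro l hl
  induction l with
  | nil => simp
  | cons k l ih =>
    rw [List.nodup_cons] at hl
    rw [List.flatMap_cons, ih hl.2]
    by_cases h : i = k
    · subst h
      simp [hl.1]
    · simp [h]

/-- The words `b₁, …, bₘ` written side by side, each completed by sure letters. -/
def jointWord {m : ℕ} (b : Fin m → List (Letter 𝓑)) : List (Σ x, Fin m → (𝓑 x).Event) :=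
  (List.finRange m).flatMap fun k =>
    (b k).map fun a => ⟨a.1, fun i => if i = k then a.2 else (𝓑 a.1).sure⟩

/-- Row `i` is nontrivial at most in block `i`. The word `b i` may itself contain sure letters,
hence the stripping on both sides. -/
theorem stripSure_jointWord {m : ℕ} (b : Fin m → List (Letter 𝓑)) (i : Fin m) :
    stripSure ((jointWord b).map fun a => ⟨a.1, a.2 i⟩) = stripSure (b i) := by
  classical
  have h := List.flatMap_ite_eq (fun k => stripSure (b k)) i _ (List.nodup_finRange m)
  rw [if_pos (List.mem_finRange i)] at h
  rw [← h, jointWord, List.map_flatMap, stripSure, List.filter_flatMap]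
  congr 1
  funext k
  by_cases hik : i = k
  · simp [hik, stripSure, Function.comp_def]
  · simp only [hik, List.map_map, Function.comp_def, if_false]
    refine List.filter_eq_nil_iff.2 fun a ha => ?_
    obtain ⟨c, -, rfl⟩ := List.mem_map.1 ha
    simp

namespace IsWordKernel

variable {F : List (LetterPair 𝓑) → ℂ}

/-- The joint word turns words over different points into rows over common points, where positivity
is assumed; the padding does not affect `wordGram`. -/
theorem posKernel_wordGram (hF : IsWordKernel F) : PosKernel (wordGram F) := by
  intro m b c
  refine (hF.pos m (jointWord b) m id c).trans_eq ?_
  refine Finset.sum_congr rfl fun i _ => Finset.sum_congr rfl fun j _ => ?_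
  simp only [id]
  rw [hF.eq_wordGram, ← hF.wordGram_stripSure, List.map_map, List.map_map,
    ← hF.wordGram_stripSure (b i), ← stripSure_jointWord b i, ← stripSure_jointWord b j]
  rfl

theorem wordGram_nil (hF : IsWordKernel F) : wordGram F [] [] = 1 := hF.nil

/-- The symmetry of the future projections: the left letter is moved past the right word to the end,
where factorizability transfers it to the other side. -/
theorem wordGram_append_left (hF : IsWordKernel F) (w w' : List (Letter 𝓑)) (a : Letter 𝓑) :
    wordGram F (w ++ [a]) w' = wordGram F w (w' ++ [a]) := by
  have h1 := hF.left_past_right (w.map leftLetter) [] a w'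
  have h2 := hF.factor (w.map leftLetter ++ w'.map rightLetter) a.1 (𝓑 a.1).sure (𝓑 a.1).sure a.2
  simp only [SigmaSemiring.sure_mul, List.append_assoc, List.append_nil] at h1 h2
  simp only [wordGram, List.map_append, List.map_cons, List.map_nil, List.append_assoc,
    List.cons_append, List.nil_append]
  exact h1.trans h2

theorem wordGram_merge (hF : IsWordKernel F) (w w' : List (Letter 𝓑)) (x : X)
    (B C : (𝓑 x).Event) :
    wordGram F (w ++ [⟨x, B⟩] ++ [⟨x, C⟩]) w' = wordGram F (w ++ [⟨x, (𝓑 x).mul B C⟩]) w' := by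
  have := hF.merge (w.map leftLetter) (w'.map rightLetter) x B (𝓑 x).sure C (𝓑 x).sure
  rw [SigmaSemiring.mul_sure] at this
  simpa [wordGram, leftLetter] using this

theorem wordGram_sure (hF : IsWordKernel F) (w w' : List (Letter 𝓑)) (x : X) :
    wordGram F (w ++ [⟨x, (𝓑 x).sure⟩]) w' = wordGram F w w' := by
  have := hF.sure (w.map leftLetter) (w'.map rightLetter) x
  simpa [wordGram, leftLetter] using this

theorem hasSum_wordGram (hF : IsWordKernel F) (w : List (Letter 𝓑)) (x : X) {B : (𝓑 x).Event}
    {f : ℕ → (𝓑 x).Event} (hf : (𝓑 x).IsDisjointSum B f) :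
    HasSum (fun m => wordGram F (w ++ [⟨x, f m⟩]) (w ++ [⟨x, f m⟩]))
      (wordGram F (w ++ [⟨x, B⟩]) (w ++ [⟨x, B⟩])) := by
  have h : ∀ w, F (diagWord w) = wordGram F w w := by
    intro w
    rw [hF.eq_wordGram]
    simp [diagWord, Function.comp_def]
  simpa only [h] using hF.sigma w x B f hf

/-- The empty event is the disjoint sum of infinitely many copies of itself, and a constant summable
sequence vanishes. -/
theorem wordGram_empty (hF : IsWordKernel F) (w : List (Letter 𝓑)) (x : X) {B : (𝓑 x).Event}
    (hB : B.1 = ∅) : wordGram F (w ++ [⟨x, B⟩]) (w ++ [⟨x, B⟩]) = 0 := by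
  have h := hF.hasSum_wordGram w x (B := B) (f := fun _ => B) ⟨by simp [Pairwise, hB], by simp [hB]⟩
  exact (summable_const_iff _).1 h.summable

end IsWordKernel

end Gram

/-! ### The process of a word kernel -/

section Construction

variable {X : Type u} {E : X → Type v} {𝓑 : ∀ x, SigmaSemiring (E x)}
  {H : Type w} [NormedAddCommGroup H] [InnerProductSpace ℂ H]

theorem gram_ext {F : List (LetterPair 𝓑) → ℂ} {φ : List (Letter 𝓑) → H}
    (hG : ∀ w w', ⟪φ w, φ w'⟫_ℂ = wordGram F w w') {w w' : List (Letter 𝓑)}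
    (h : ∀ r, wordGram F w r = wordGram F w' r) : φ w = φ w' := by
  rw [← sub_eq_zero, ← inner_self_eq_zero (𝕜 := ℂ), inner_sub_left, inner_sub_right,
    inner_sub_right, hG, hG, hG, hG, h, h]
  simp

variable [CompleteSpace H]

/-- The projection onto the closed span of the vectors of the words that end in a given letter. -/
noncomputable def letterProjection (φ : List (Letter 𝓑) → H) (a : Letter 𝓑) : H →L[ℂ] H :=
  (Submodule.span ℂ (Set.range fun w => φ (w ++ [a]))).topologicalClosure.starProjection

namespace IsWordKernel

variable {F : List (LetterPair 𝓑) → ℂ} {φ : List (Letter 𝓑) → H}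

/-- The difference `φ w - φ (w a)` is orthogonal to every `φ (r a)`: symmetry moves the final `a` of
`r a` onto the left word, where a repeated `a` merges into one. Starting from an orthogonal
projection avoids checking that appending a letter is well defined on the span. -/
theorem letterProjection_apply (hF : IsWordKernel F)
    (hG : ∀ w w', ⟪φ w, φ w'⟫_ℂ = wordGram F w w') (a : Letter 𝓑) (w : List (Letter 𝓑)) :
    letterProjection φ a (φ w) = φ (w ++ [a]) := by
  obtain ⟨x, B⟩ := a
  refine Submodule.eq_starProjection_of_mem_orthogonal ?_ ?_
  · exact Submodule.le_topologicalClosure _ (Submodule.subset_span ⟨w, rfl⟩)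
  · rw [Submodule.orthogonal_closure, Submodule.mem_orthogonal']
    intro y hy
    induction hy using Submodule.span_induction with
    | mem y hy =>
      obtain ⟨r, rfl⟩ := hy
      rw [inner_sub_left, hG, hG, sub_eq_zero, ← hF.wordGram_append_left,
        ← hF.wordGram_append_left, hF.wordGram_merge, SigmaSemiring.mul_self]
    | zero => simp
    | add y z _ _ hy hz => rw [inner_add_right, hy, hz, add_zero]
    | smul c y _ hy => rw [inner_smul_right, hy, mul_zero]

/-- The process whose vectors `π_{xₙ}(Bₙ) ⋯ π_{x₁}(B₁) ξ` are the given ones. -/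
noncomputable def process (hF : IsWordKernel F) (hG : ∀ w w', ⟪φ w, φ w'⟫_ℂ = wordGram F w w')
    (hφ : (Submodule.span ℂ (Set.range φ)).topologicalClosure = ⊤) : NarrowQSP 𝓑 H :=
  -- Two successive letters at `x` merge into their intersection, which is empty, and such a word
  -- has a null vector.
  have orth : ∀ x (f : ℕ → (𝓑 x).Event), (𝓑 x).IsDisjointSum (𝓑 x).sure f →
      Pairwise fun m m' =>
        letterProjection φ ⟨x, f m⟩ ∘L letterProjection φ ⟨x, f m'⟩ = 0 := by
    intro x f hf m m' hm
    refine ContinuousLinearMap.ext_of_total hφ fun w => ?_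
    rw [ContinuousLinearMap.comp_apply, hF.letterProjection_apply hG,
      hF.letterProjection_apply hG, gram_ext hG fun r => hF.wordGram_merge w r x (f m') (f m)]
    rw [zero_apply, ← inner_self_eq_zero (𝕜 := ℂ), hG]
    exact hF.wordGram_empty w x (hf.1 hm.symm)
  { π := fun x B => letterProjection φ ⟨x, B⟩
    ξ := φ []
    isStarProjection := fun _ _ => isStarProjection_starProjection
    map_sure := fun x => ContinuousLinearMap.ext_of_total hφ fun w => by
      rw [hF.letterProjection_apply hG]
      exact gram_ext hG fun r => hF.wordGram_sure w r x
    orthogonal := orth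
    hasSum := fun x f hf => by
      refine hasSum_of_orthogonal_projections hφ (fun _ => isStarProjection_starProjection)
        (orth x f hf) fun w => ?_
      have h := hF.hasSum_wordGram w x hf
      simp only [← hG] at h
      rw [gram_ext hG fun r => hF.wordGram_sure w r x] at h
      simpa only [hF.letterProjection_apply hG] using h
    norm_ξ := by
      have h : ⟪φ [], φ []⟫_ℂ = 1 := by rw [hG, hF.wordGram_nil]
      rw [@norm_eq_sqrt_re_inner ℂ, h]
      simp }

end IsWordKernel

end Construction

/-! ### Word vectors and minimality -/

namespace NarrowQSP

section General

variable {T : Type u} {E : T → Type v} {𝓑 : ∀ t, SigmaSemiring (E t)}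
  {H : Type w} [NormedAddCommGroup H] [InnerProductSpace ℂ H] [CompleteSpace H]

/-- The vector `π_{tₙ}(Bₙ) ⋯ π_{t₁}(B₁) ξ` of a word. -/
def wordVec (P : NarrowQSP 𝓑 H) (w : List (Letter 𝓑)) : H :=
  w.foldl (fun v a => P.π a.1 a.2 v) P.ξ

theorem vec_eq_wordVec (P : NarrowQSP 𝓑 H) {n : ℕ} (t : Fin n → T) (B : ∀ i, (𝓑 (t i)).Event) :
    P.vec t B = P.wordVec (List.ofFn fun i => ⟨t i, B i⟩) := by
  rw [vec, wordVec, List.ofFn_eq_map, List.foldl_map]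

theorem wordVec_append (P : NarrowQSP 𝓑 H) (w : List (Letter 𝓑)) (a : Letter 𝓑) :
    P.wordVec (w ++ [a]) = P.π a.1 a.2 (P.wordVec w) := by
  rw [wordVec, List.foldl_append]
  rfl

/-- Commuting operators are determined on the vectors of words by their value at `ξ`. -/
theorem map_wordVec_eq_zero (P : NarrowQSP 𝓑 H) {A : H →L[ℂ] H}
    (hA : ∀ t B, A ∘L P.π t B = P.π t B ∘L A) (hξ : A P.ξ = 0) (w : List (Letter 𝓑)) :
    A (P.wordVec w) = 0 := by
  induction w using List.reverseRecOn with
  | nil => exact hξ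
  | append_singleton w a ih =>
    rw [wordVec_append]
    have := DFunLike.congr_fun (hA a.1 a.2) (P.wordVec w)
    simpa [ih] using this

theorem isMinimal_of_total (P : NarrowQSP 𝓑 H)
    (h : (Submodule.span ℂ (Set.range P.wordVec)).topologicalClosure = ⊤) : P.IsMinimal :=
  fun _ hA hξ => ContinuousLinearMap.ext_of_total h fun w => P.map_wordVec_eq_zero hA hξ w

/-- The closed span `M` of the word vectors reduces every `π t B`, so its projection lies in the
commutant. Its complement `I - M.starProjection` annihilates `ξ`, and hence vanishes by minimality.
-/
theorem IsMinimal.total {P : NarrowQSP 𝓑 H} (hP : P.IsMinimal) :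
    (Submodule.span ℂ (Set.range P.wordVec)).topologicalClosure = ⊤ := by
  set M := (Submodule.span ℂ (Set.range P.wordVec)).topologicalClosure with hM
  have inv : ∀ t B, ∀ y ∈ M, P.π t B y ∈ M := by
    intro t B y hy
    have hs : Submodule.span ℂ (Set.range P.wordVec) ≤ M.comap (P.π t B).toLinearMap := by
      rw [Submodule.span_le]
      rintro _ ⟨w, rfl⟩
      exact Submodule.le_topologicalClosure _
        (Submodule.subset_span ⟨w ++ [⟨t, B⟩], P.wordVec_append w ⟨t, B⟩⟩)
    exact Submodule.topologicalClosure_minimal _ hs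
      ((Submodule.isClosed_topologicalClosure _).preimage (P.π t B).continuous) hy
  have inv' : ∀ t B, ∀ y ∈ Mᗮ, P.π t B y ∈ Mᗮ := by
    intro t B y hy
    rw [Submodule.mem_orthogonal] at hy ⊢
    intro z hz
    rw [← ContinuousLinearMap.adjoint_inner_left,
      ContinuousLinearMap.isSelfAdjoint_iff'.1 (P.isStarProjection t B).isSelfAdjoint]
    exact hy _ (inv t B z hz)
  have comm : ∀ t B y, M.starProjection (P.π t B y) = P.π t B (M.starProjection y) := by
    intro t B y
    refine Submodule.eq_starProjection_of_mem_orthogonal (inv t B _ ?_) ?_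
    · exact (M.orthogonalProjectionOnto y).2
    · rw [← map_sub]
      exact inv' t B _ (Submodule.sub_starProjection_mem_orthogonal y)
  have h0 := hP (ContinuousLinearMap.id ℂ H - M.starProjection)
    (fun t B => ContinuousLinearMap.ext fun y => by simp [comm]) (by
      have : P.ξ ∈ M := Submodule.le_topologicalClosure _ (Submodule.subset_span ⟨[], rfl⟩)
      simp [Submodule.starProjection_eq_self_iff.2 this])
  rw [eq_top_iff]
  intro y _
  rw [← Submodule.starProjection_eq_self_iff]
  have := DFunLike.congr_fun h0 y
  exact (sub_eq_zero.1 this).symm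

theorem wordVec_append_sure (P : NarrowQSP 𝓑 H) (w : List (Letter 𝓑)) {r : List (Letter 𝓑)}
    (hr : ∀ a ∈ r, a.2 = (𝓑 a.1).sure) : P.wordVec (w ++ r) = P.wordVec w := by
  induction r using List.reverseRecOn with
  | nil => simp
  | append_singleton r a ih =>
    rw [← List.append_assoc, wordVec_append, ih fun b hb => hr b (by simp [hb]),
      hr a (by simp), P.map_sure]
    rfl

theorem wordVec_sure_append (P : NarrowQSP 𝓑 H) (w : List (Letter 𝓑)) {r : List (Letter 𝓑)}
    (hr : ∀ a ∈ r, a.2 = (𝓑 a.1).sure) : P.wordVec (r ++ w) = P.wordVec w := by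
  have h := P.wordVec_append_sure [] hr
  rw [List.nil_append] at h
  rw [wordVec, List.foldl_append]
  change List.foldl _ (P.wordVec r) w = _
  rw [h]
  rfl

end General

section Lift

variable {X : Type u} {E : X → Type v} {𝓑 : ∀ x, SigmaSemiring (E x)}
  {H : Type w} [NormedAddCommGroup H] [InnerProductSpace ℂ H] [CompleteSpace H]

/-- The quasiconstant process `π_{(l,x)} = π_x`. -/
def lift (Q : NarrowQSP 𝓑 H) : NarrowQSP (liftFamily 𝓑) H where
  π t B := Q.π (ofLex t).2 B
  ξ := Q.ξ
  isStarProjection t B := Q.isStarProjection (ofLex t).2 B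
  map_sure t := Q.map_sure (ofLex t).2
  orthogonal t := Q.orthogonal (ofLex t).2
  hasSum t := Q.hasSum (ofLex t).2
  norm_ξ := Q.norm_ξ

/-- The process `π_x = π_{(0,x)}`. -/
def levelZero (P : NarrowQSP (liftFamily 𝓑) H) : NarrowQSP 𝓑 H where
  π x B := P.π (toLex (0, x)) B
  ξ := P.ξ
  isStarProjection x B := P.isStarProjection (toLex (0, x)) B
  map_sure x := P.map_sure (toLex (0, x))
  orthogonal x := P.orthogonal (toLex (0, x))
  hasSum x := P.hasSum (toLex (0, x))
  norm_ξ := P.norm_ξ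

theorem isReduction_levelZero {P : NarrowQSP (liftFamily 𝓑) H} (hP : IsQuasiconstant P) :
    IsReduction P P.levelZero := by
  refine ⟨rfl, fun t B => ?_⟩
  -- The shift by `-l` brings the point `(l, x)` to level `0`.
  rw [hP (-(ofLex t).1) t B]
  obtain ⟨l, x⟩ := t
  change P.π (toLex (l + -l, x)) B = P.π (toLex (0, x)) B
  rw [add_neg_cancel]

end Lift

end NarrowQSP

/-! ### Induced kernels -/

section Induced

variable {X : Type u} {E : X → Type v} {𝓑 : ∀ x, SigmaSemiring (E x)} {α : X → Type w'}

theorem totalEvent_of_unique {f : ∀ x, α x → (𝓑 x).Event} {L : List (ℤ × Σ x, α x)} {l : ℤ}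
    {x : X} {c : α x} (hc : (l, ⟨x, c⟩) ∈ L) (hu : ∀ a : α x, (l, ⟨x, a⟩) ∈ L → a = c) :
    totalEvent f L (toLex (l, x)) = f x c := by
  refine Subtype.ext (Set.ext fun p => ?_)
  refine mem_totalEvent.trans ⟨fun H => H c hc, fun H a ha => ?_⟩
  rw [hu a ha]
  exact H

variable {H : Type w} [NormedAddCommGroup H] [InnerProductSpace ℂ H] [CompleteSpace H]

theorem IsWordKernel.wordVec_process {F : List (LetterPair 𝓑) → ℂ} {φ : List (Letter 𝓑) → H}
    (hF : IsWordKernel F) (hG : ∀ w w', ⟪φ w, φ w'⟫_ℂ = wordGram F w w')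
    (hφ : (Submodule.span ℂ (Set.range φ)).topologicalClosure = ⊤) (w : List (Letter 𝓑)) :
    (hF.process hG hφ).wordVec w = φ w := by
  induction w using List.reverseRecOn with
  | nil => rfl
  | append_singleton w a ih =>
    rw [NarrowQSP.wordVec_append, ih]
    exact hF.letterProjection_apply hG a w

theorem NarrowQSP.isMinimal_iff_of_isReduction {P : NarrowQSP (liftFamily 𝓑) H} {Q : NarrowQSP 𝓑 H}
    (hQ : IsReduction P Q) : P.IsMinimal ↔ Q.IsMinimal := by
  have hπ : ∀ (t : ℤ ×ₗ X) (B : (liftFamily 𝓑 t).Event), P.π t B = Q.π (ofLex t).2 B := hQ.2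
  constructor
  · intro h A hA hξ
    exact h A (fun t B => by rw [hπ]; exact hA _ _) (by rw [← hQ.1]; exact hξ)
  · intro h A hA hξ
    refine h A (fun x B => ?_) (by rw [hQ.1]; exact hξ)
    rw [show Q.π x B = P.π (toLex (0, x)) B from (hπ (toLex (0, x)) B).symm]
    exact hA (toLex (0, x)) B

variable [PartialOrder X] {κ : Multikernels (liftFamily 𝓑)}

/-- The points of a chain are distinct, so each carries a single letter and its total event is the
given one. -/
theorem Multikernels.eq_word (hproj : κ.IsProjective) (h5 : IsUltrastationary κ)
    (Λ : FinChain (ℤ ×ₗ X)) {n : ℕ} (t : Fin n ≃o Λ.1) (b b' : EventSeq (liftFamily 𝓑) Λ) :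
    κ Λ b b' = κ.word (List.ofFn fun i => ⟨(ofLex (t i).1).2, (b (t i), b' (t i))⟩) := by
  let L : List (ℤ × LetterPair 𝓑) := List.ofFn fun i =>
    ((ofLex (t i).1).1, ⟨(ofLex (t i).1).2, (b (t i), b' (t i))⟩)
  have hL : IsSortedWord L := by
    rw [IsSortedWord, List.pairwise_ofFn]
    exact fun i j hij => t.monotone hij.le
  have key : ∀ f : ∀ y, (𝓑 y).Event × (𝓑 y).Event → (𝓑 y).Event, ∀ i,
      totalEvent f L (t i).1 = f (ofLex (t i).1).2 (b (t i), b' (t i)) := by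
    intro f i
    refine totalEvent_of_unique (l := (ofLex (t i).1).1) (x := (ofLex (t i).1).2)
      ((List.mem_ofFn' _ _).2 ⟨i, rfl⟩) fun a ha => ?_
    obtain ⟨j, hj⟩ := (List.mem_ofFn' _ _).1 ha
    have hij : j = i := by
      apply t.injective
      apply Subtype.ext
      have h1 := congrArg Prod.fst hj
      have h2 := congrArg (fun a => a.2.1) hj
      exact Prod.ext h1 h2
    subst hij
    simpa using hj.symm
  rw [word_eq_onWord hproj h5 hL (Λ := Λ)]
  · unfold onWord
    congr 1
    · funext r
      obtain ⟨i, rfl⟩ := t.surjective r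
      exact (key (fun _ => Prod.fst) i).symm
    · funext r
      obtain ⟨i, rfl⟩ := t.surjective r
      exact (key (fun _ => Prod.snd) i).symm
  · intro a ha
    obtain ⟨i, rfl⟩ := (List.mem_ofFn' _ _).1 ha
    exact (t i).2
  · rw [List.map_ofFn]
    rfl

theorem Multikernels.onSeq_eq_word (hproj : κ.IsProjective) (h5 : IsUltrastationary κ) {n : ℕ}
    (x : Fin n → X) (s : Fin n → ℤ) (hs : Monotone (pairSeq s x))
    (B B' : ∀ i, (𝓑 (x i)).Event) :
    κ.onSeq (pairSeq s x) hs B B' = κ.word (List.ofFn fun i => ⟨x i, (B i, B' i)⟩) := by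
  rw [onSeq_eq_onWord]
  symm
  refine word_eq_onWord hproj h5 (isSortedWord_ofFn.2 hs) ?_ ?_
  · intro a ha
    obtain ⟨i, rfl⟩ := (List.mem_ofFn' _ _).1 ha
    simp only [chainOf, Finset.mem_image, Finset.mem_univ, true_and]
    exact ⟨i, rfl⟩
  · rw [List.map_ofFn]
    rfl

namespace NarrowQSP

/-- The kernels of words determine the kernels of all chains. -/
theorem induces_lift (hproj : κ.IsProjective) (h5 : IsUltrastationary κ) {Q : NarrowQSP 𝓑 H}
    (hQ : ∀ d : List (LetterPair 𝓑), κ.word d = ⟪Q.wordVec (d.map fun a => ⟨a.1, a.2.1⟩),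
      Q.wordVec (d.map fun a => ⟨a.1, a.2.2⟩)⟫_ℂ) : Q.lift.Induces κ := by
  intro Λ n t b b'
  have h : ∀ c : EventSeq (liftFamily 𝓑) Λ,
      Q.lift.vec (fun i => (t i).1) (fun i => c (t i)) =
        Q.wordVec (List.ofFn fun i => ⟨(ofLex (t i).1).2, c (t i)⟩) := by
    exact fun c => Q.vec_eq_wordVec (fun i => (ofLex (t i).1).2) fun i => c (t i)
  rw [Multikernels.eq_word hproj h5 Λ t, hQ, List.map_ofFn, List.map_ofFn, h, h]
  rfl

theorem hasOrderedKernels (hproj : κ.IsProjective) (h5 : IsUltrastationary κ) {Q : NarrowQSP 𝓑 H}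
    (hQ : ∀ d : List (LetterPair 𝓑), κ.word d = ⟪Q.wordVec (d.map fun a => ⟨a.1, a.2.1⟩),
      Q.wordVec (d.map fun a => ⟨a.1, a.2.2⟩)⟫_ℂ) : HasOrderedKernels Q κ := by
  intro n x s hs B B'
  rw [Multikernels.onSeq_eq_word hproj h5, hQ, List.map_ofFn, List.map_ofFn, vec_eq_wordVec,
    vec_eq_wordVec]
  rfl

/-- The kernels of words are the inner products of the vectors of any quasiconstant process that
induces the multikernels. -/
theorem Induces.word_eq {P : NarrowQSP (liftFamily 𝓑) H} (hP : P.Induces κ) {Q : NarrowQSP 𝓑 H}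
    (hQ : IsReduction P Q) (d : List (LetterPair 𝓑)) :
    κ.word d = ⟪Q.wordVec (d.map fun a => ⟨a.1, a.2.1⟩),
      Q.wordVec (d.map fun a => ⟨a.1, a.2.2⟩)⟫_ℂ := by
  have hlt := pairwise_withLevels 0 d
  have hs := isSortedWord_of_lt hlt
  have hd : (withLevels 0 d).map Prod.snd = d := map_snd_withLevels 0 d
  change κ (wordChain _ hs) (totalSeq (fun _ => Prod.fst) (withLevels 0 d) _)
    (totalSeq (fun _ => Prod.snd) (withLevels 0 d) _) = _
  generalize withLevels 0 d = L at hlt hs hd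
  subst hd
  have hmono : ∀ i j : Fin L.length, i < j → L[i].1 < L[j].1 := fun i j hij =>
    List.pairwise_iff_getElem.1 hlt i j i.2 j.2 hij
  -- The levels increase strictly, so running through `L` is the increasing enumeration of its
  -- chain.
  let t : Fin L.length ≃o (wordChain L hs).1 := StrictMono.orderIsoOfSurjective
    (fun i => ⟨levelPoint L[i], mem_wordChain.2 ⟨L[i], List.getElem_mem _, rfl⟩⟩)
    (fun i j hij => levelPoint_lt_of_lt (hmono i j hij)) (by
      rintro ⟨r, hr⟩
      obtain ⟨a, ha, rfl⟩ := mem_wordChain.1 hr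
      obtain ⟨i, hi, rfl⟩ := List.getElem_of_mem ha
      exact ⟨⟨i, hi⟩, rfl⟩)
  have key : ∀ f : ∀ y, (𝓑 y).Event × (𝓑 y).Event → (𝓑 y).Event,
      P.vec (fun i => (t i).1) (fun i => totalSeq f L (wordChain L hs) (t i)) =
        Q.wordVec ((L.map Prod.snd).map fun a => ⟨a.1, f a.1 a.2⟩) := by
    intro f
    have e : ∀ i : Fin L.length, totalEvent f L (levelPoint L[i]) = f L[i].2.1 L[i].2.2 := by
      intro i
      refine totalEvent_of_unique (List.getElem_mem i.2) fun a ha => ?_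
      obtain ⟨j, hj, hja⟩ := List.getElem_of_mem ha
      have hij : (⟨j, hj⟩ : Fin L.length) = i := by
        have h1 : (L[(⟨j, hj⟩ : Fin L.length)]).1 = L[i].1 :=
          (congrArg Prod.fst hja :)
        rcases lt_trichotomy (⟨j, hj⟩ : Fin L.length) i with h | h | h
        · exact absurd h1 (hmono _ _ h).ne
        · exact h
        · exact absurd h1 (hmono _ _ h).ne'
      subst hij
      have := congrArg Prod.snd hja
      simpa [Sigma.ext_iff] using this.symm
    have hv : P.vec (fun i => (t i).1) (fun i => totalSeq f L (wordChain L hs) (t i)) =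
        Q.vec (fun i => L[i].2.1) (fun i => f L[i].2.1 L[i].2.2) := by
      unfold vec
      rw [hQ.1]
      congr 1
      funext v i
      refine (DFunLike.congr_fun ?_ v)
      exact (hQ.2 (levelPoint L[i]) (totalEvent f L (levelPoint L[i]))).trans
        (congrArg (Q.π L[i].2.1) (e i))
    rw [hv, vec_eq_wordVec, List.map_map]
    congr 1
    exact List.ext_getElem (by simp) fun i _ _ => by simp
  have := hP (wordChain L hs) L.length t (totalSeq (fun _ => Prod.fst) L _)
    (totalSeq (fun _ => Prod.snd) L _)
  rw [key, key] at this
  exact this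

/-- In the word defining `wordGram`, the left events are `w` followed by sure events and the right
events are sure events followed by `w'`; the sure ones act as the identity. Thus `κ` fixes the inner
products of all word vectors, which yields uniqueness. -/
theorem Induces.inner_wordVec {P : NarrowQSP (liftFamily 𝓑) H} (hP : P.Induces κ)
    {Q : NarrowQSP 𝓑 H} (hQ : IsReduction P Q) (w w' : List (Letter 𝓑)) :
    ⟪Q.wordVec w, Q.wordVec w'⟫_ℂ = wordGram κ.word w w' := by
  rw [wordGram, hP.word_eq hQ, List.map_append, List.map_append, List.map_map, List.map_map,
    List.map_map, List.map_map, wordVec_append_sure, wordVec_sure_append]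
  · simp [Function.comp_def, leftLetter, rightLetter]
  · intro a ha
    obtain ⟨c, -, rfl⟩ := List.mem_map.1 ha
    rfl
  · intro a ha
    obtain ⟨c, -, rfl⟩ := List.mem_map.1 ha
    rfl

end NarrowQSP

end Induced

/-! ### Existence and uniqueness of the minimal process -/

theorem theorem1 {X : Type u} [PartialOrder X] {E : X → Type v}
    (𝓑 : ∀ x, SigmaSemiring (E x)) (κ : Multikernels (liftFamily 𝓑))
    (hproj : κ.IsProjective) (h1 : κ.IsPositive) (h2 : κ.IsNormalized)
    (h3 : κ.IsSigmaAdditive) (h4 : κ.IsFactorizable) (h5 : IsUltrastationary κ) :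
    (∃ (H : Type (max u v)) (_ : NormedAddCommGroup H) (_ : InnerProductSpace ℂ H)
        (_ : CompleteSpace H) (P : NarrowQSP (liftFamily 𝓑) H),
        IsQuasiconstant P ∧ P.Induces κ ∧ P.IsMinimal ∧
        ∃ Q : NarrowQSP 𝓑 H, IsReduction P Q ∧ HasOrderedKernels Q κ) ∧
    (∀ (H₁ : Type w) (H₂ : Type w') [NormedAddCommGroup H₁] [InnerProductSpace ℂ H₁]
        [CompleteSpace H₁] [NormedAddCommGroup H₂] [InnerProductSpace ℂ H₂] [CompleteSpace H₂]
        (P₁ : NarrowQSP (liftFamily 𝓑) H₁) (P₂ : NarrowQSP (liftFamily 𝓑) H₂),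
        IsQuasiconstant P₁ → P₁.Induces κ → P₁.IsMinimal →
        IsQuasiconstant P₂ → P₂.Induces κ → P₂.IsMinimal →
        P₁.UnitarilyEquivalent P₂) := by
  constructor
  · have hF := Multikernels.isWordKernel_word hproj h1 h2 h3 h4 h5
    obtain ⟨H, _, _, _, φ, hG, hφ⟩ := hF.posKernel_wordGram.exists_hilbert
    have hvec := hF.wordVec_process hG hφ
    have hword : ∀ d : List (LetterPair 𝓑), κ.word d =
        ⟪(hF.process hG hφ).wordVec (d.map fun a => ⟨a.1, a.2.1⟩),
          (hF.process hG hφ).wordVec (d.map fun a => ⟨a.1, a.2.2⟩)⟫_ℂ := by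
      intro d
      rw [hvec, hvec, hG, ← hF.eq_wordGram]
    have hred : IsReduction (hF.process hG hφ).lift (hF.process hG hφ) := ⟨rfl, fun _ _ => rfl⟩
    refine ⟨H, inferInstance, inferInstance, inferInstance, (hF.process hG hφ).lift,
      fun _ _ _ => rfl, NarrowQSP.induces_lift hproj h5 hword, ?_, hF.process hG hφ, hred,
      NarrowQSP.hasOrderedKernels hproj h5 hword⟩
    rw [NarrowQSP.isMinimal_iff_of_isReduction hred]
    apply NarrowQSP.isMinimal_of_total
    rwa [show (hF.process hG hφ).wordVec = φ from funext hvec]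
  · intro H₁ H₂ _ _ _ _ _ _ P₁ P₂ c₁ i₁ m₁ c₂ i₂ m₂
    have r₁ := NarrowQSP.isReduction_levelZero c₁
    have r₂ := NarrowQSP.isReduction_levelZero c₂
    have t₁ := ((NarrowQSP.isMinimal_iff_of_isReduction r₁).1 m₁).total
    have t₂ := ((NarrowQSP.isMinimal_iff_of_isReduction r₂).1 m₂).total
    obtain ⟨U, hU⟩ := exists_unitary_of_gram_eq t₁ t₂ fun w w' => by
      rw [i₁.inner_wordVec r₁, i₂.inner_wordVec r₂]
    refine ⟨U, hU [], fun t B x => ?_⟩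
    -- On word vectors both sides append the same letter, and the word vectors are total.
    have h : U.toLinearIsometry.toContinuousLinearMap ∘L P₁.π t B =
        P₂.π t B ∘L U.toLinearIsometry.toContinuousLinearMap := by
      refine ContinuousLinearMap.ext_of_total t₁ fun w => ?_
      rw [show P₁.π t B = P₁.levelZero.π (ofLex t).2 B from r₁.2 t B,
        show P₂.π t B = P₂.levelZero.π (ofLex t).2 B from r₂.2 t B]
      change U (P₁.levelZero.π _ B (P₁.levelZero.wordVec w)) =
        P₂.levelZero.π _ B (U (P₁.levelZero.wordVec w))
      rw [hU]
      have e₁ := P₁.levelZero.wordVec_append w ⟨_, B⟩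
      have e₂ := P₂.levelZero.wordVec_append w ⟨_, B⟩
      exact (congrArg U e₁).symm.trans ((hU _).trans e₂)
    exact DFunLike.congr_fun h x
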